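/- Let $k\ge 1$. For $n\in\mathbb N$ let $C_k(n)$ be the set of all $\binom nk 2^k$ $k$-clauses on $n$ Boolean variables (disjunctions of $k$ literals on $k$ distinct variables), and for $\alpha\ge 0$ let $F(n,\alpha)$ be the random formula obtained as the conjunction of the clauses of a random subset of $C_k(n)$ in which each clause is included independently with probability $p=\alpha n/(\binom nk 2^k)$ (this is at most $1$ for all large $n$ in the range of $\alpha$ considered below; otherwise it is truncated to $1$). Let $Z(F)$ be the number of satisfying assignments of $F$, and define $$\alpha^* := \sup\Big\{\alpha\ge 0 : \mathbb P\{Z(F(n,\alpha))=0\} = O\big(1/(\log n)^{1+\varepsilon}\big)\ (n\to\infty)\ \text{for some } \varepsilon>0\Big\}.$$ Let $$\psi_n(\alpha) := \frac1n\,\mathbb E\big[\log_2 Z(F(n,\alpha)) \,\big|\, Z(F(n,\alpha))\ge 1\big].$$ Then for every $\alpha\in[0,\alpha^*)$ the sequence $\psi_n(\alpha)$ converges, as $n\to\infty$, to a (finite) limit $\phi_s(\alpha)$. -/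

import Mathlib

open MeasureTheory ProbabilityTheory Filter Topology Asymptotics

noncomputable section

namespace RandomKSat

/-- A literal on the Boolean variables `x_i`, `i : Fin n`: the pair `(i, b)` stands for `x_i` if
`b = true` and for the negation of `x_i` if `b = false`. -/
abbrev Literal (n : ℕ) : Type := Fin n × Bool

/-- The set `C_k(n)` of all `k`-clauses on `n` Boolean variables: sets of `k` literals whose
underlying variables are pairwise distinct. There are `(n choose k) * 2 ^ k` of them. -/
abbrev Clause (k n : ℕ) : Type :=
  {c : Finset (Literal n) // c.card = k ∧ Set.InjOn Prod.fst (c : Set (Literal n))}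

/-- A `k`-CNF formula: a set of `k`-clauses, read as their conjunction. -/
abbrev Formula (k n : ℕ) : Type := Set (Clause k n)

/-- The assignment `x` satisfies the formula `F`: each clause contains a true literal. -/
def Satisfies {k n : ℕ} (x : Fin n → Bool) (F : Formula k n) : Prop :=
  ∀ c ∈ F, ∃ l ∈ c.1, x l.1 = l.2

/-- `Z(F)`, the number of satisfying assignments of `F`. -/
def Z {k n : ℕ} (F : Formula k n) : ℕ :=
  {x : Fin n → Bool | Satisfies x F}.ncard

/-- The clause probability `α n / ((n choose k) 2 ^ k)`, truncated to `[0, 1]`. -/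
def clauseProb (k n : ℕ) (α : ℝ) : unitInterval :=
  Set.projIcc (0 : ℝ) 1 zero_le_one (α * n / ((n.choose k : ℝ) * 2 ^ k))

/-- The law of the random formula `F_k(n, α)`: each clause of `C_k(n)` is selected independently
with probability `clauseProb k n α`. -/
def formulaLaw (k n : ℕ) (α : ℝ) : Measure (Formula k n) :=
  setBernoulli Set.univ (clauseProb k n α)

/-- `P_n(α, φ)`, the probability that `F_k(n, α)` has fewer than `2 ^ (n φ)` solutions. -/
def P (k n : ℕ) (α φ : ℝ) : ℝ :=
  (formulaLaw k n α).real {F | (Z F : ℝ) < (2 : ℝ) ^ ((n : ℝ) * φ)}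

/-- `α^*`, the supremum of the densities `α ≥ 0` for which, for some `ε > 0`, the probability
`P_n(α, 0)` of being unsatisfiable is `O(1 / (log n) ^ (1 + ε))`. -/
def alphaStar (k : ℕ) : EReal :=
  sSup (Real.toEReal '' {α : ℝ | 0 ≤ α ∧ ∃ ε : ℝ, 0 < ε ∧
    (fun n : ℕ => P k n α 0) =O[atTop] (fun n : ℕ => 1 / (Real.log n) ^ (1 + ε))})

/-- `ψ_n(α) = (1 / n) E[log₂ Z(F_k(n, α)) | Z(F_k(n, α)) ≥ 1]`. -/
def psi (k n : ℕ) (α : ℝ) : ℝ :=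
  (1 / (n : ℝ)) *
    ∫ F, Real.logb 2 (Z F) ∂(ProbabilityTheory.cond (formulaLaw k n α) {F | 1 ≤ Z F})

end RandomKSat

end

/-! The proof is an interpolation argument followed by a Fekete lemma with an error term. Solutions
are counted by log(1+Z), which is finite also for unsatisfiable formulas. Each clause carries an
independent exponential clock of rate r, so that p = 1 - exp(-r). The expectation is then smooth in
the rates, and its derivative in the rate of c is the mean effect of adding c.

For n = a + b the rates move linearly from two non-interacting blocks to the uniform model. Adding c
costs -log(1-x), where x is the number of solutions violating c divided by 1+Z. Expand this in
powers of x. Summed over clauses, the j-th power counts, for each j-tuple of solutions, the clauses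
violated by all of them, and these correspond to the k-subsets of the variables on which the tuple
agrees. The proportion of k-sets lying inside m of n variables is nearly the convex function
(m/n)^k. So a uniform clause costs on average hardly more than a clause drawn from the blocks with
weights a/n and b/n (`sum_logLoss_univ_le`).

The gap between binomial ratio and power is shared, through a parameter η, between a factor 1 +
O(η/n) and an additive O(1/(ηn)). The factor is affordable because a random clause of a block costs
only O(sqrt n) on average, by a Cauchy–Schwarz bound on total influence (`sum_clockExp_logLoss_le`).
With η = n^(1/4) both errors are O(n^(3/4)) (`clockExp_splitRate_le`, `exists_meanLogSols_add_le`).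

Solution counts of independent blocks multiply, so the mean of log(1+Z) is nearly superadditive. The
exception is an unsatisfiable block, which costs O(n) times its probability, that is O(n/(log
n)^(1+ε)). Under repeated balanced splitting log n drops by at least a constant each time, so the
errors per variable sum like the convergent series of j^-(1+ε). This is
`exists_tendsto_of_superadditive_log_error`, and it explains the exponent in α*. Finally, E log(1+Z)
is within 1 of E[log Z; Z ≥ 1], and P(Z ≥ 1) tends to 1. -/

namespace RandomKSat

/-! ### Product measures with clock rates: derivative and total influence -/

/-- The probability that a Poisson clock of rate `r` has rung (`true`) or not (`false`) by time
`1`. -/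
noncomputable def clockWeight (r : ℝ) (b : Bool) : ℝ :=
  if b = true then 1 - Real.exp (-r) else Real.exp (-r)

/-- Expectation of `g` when coordinate `i` is `true` with probability `1 - exp (-r i)`,
independently over `i`. -/
noncomputable def clockExp {ι : Type*} [Fintype ι] [DecidableEq ι] (r : ι → ℝ)
    (g : (ι → Bool) → ℝ) : ℝ :=
  ∑ ω, (∏ i, clockWeight (r i) (ω i)) * g ω

section clockExp

variable {ι κ : Type*} [Fintype ι] [DecidableEq ι] [Fintype κ] [DecidableEq κ]

set_option linter.unusedSectionVars false

lemma clockWeight_nonneg {r : ℝ} (hr : 0 ≤ r) (b : Bool) : 0 ≤ clockWeight r b := by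
  unfold clockWeight
  split_ifs
  · have : Real.exp (-r) ≤ 1 := Real.exp_le_one_iff.2 (by linarith)
    linarith
  · positivity

lemma sum_clockWeight (r : ℝ) : ∑ b, clockWeight r b = 1 := by
  simp [clockWeight]

lemma sum_prod_clockWeight (r : ι → ℝ) : ∑ ω : ι → Bool, ∏ i, clockWeight (r i) (ω i) = 1 := by
  have := Finset.prod_univ_sum (fun _ : ι => (Finset.univ : Finset Bool))
    (fun i b => clockWeight (r i) b)
  rw [Fintype.piFinset_univ] at this
  rw [← this]
  exact Finset.prod_eq_one fun i _ => sum_clockWeight _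

lemma clockExp_const (r : ι → ℝ) (a : ℝ) : clockExp r (fun _ => a) = a := by
  unfold clockExp
  rw [← Finset.sum_mul, sum_prod_clockWeight, one_mul]

lemma clockExp_add (r : ι → ℝ) (g h : (ι → Bool) → ℝ) :
    clockExp r (fun ω => g ω + h ω) = clockExp r g + clockExp r h := by
  simp [clockExp, mul_add, Finset.sum_add_distrib]

lemma clockExp_sub (r : ι → ℝ) (g h : (ι → Bool) → ℝ) :
    clockExp r (fun ω => g ω - h ω) = clockExp r g - clockExp r h := by
  simp [clockExp, mul_sub, Finset.sum_sub_distrib]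

lemma clockExp_mul_left (r : ι → ℝ) (a : ℝ) (g : (ι → Bool) → ℝ) :
    clockExp r (fun ω => a * g ω) = a * clockExp r g := by
  simp only [clockExp, Finset.mul_sum]
  exact Finset.sum_congr rfl fun ω _ => by ring

lemma clockExp_sum {κ : Type*} (r : ι → ℝ) (s : Finset κ) (g : κ → (ι → Bool) → ℝ) :
    clockExp r (fun ω => ∑ j ∈ s, g j ω) = ∑ j ∈ s, clockExp r (g j) := by
  simp only [clockExp, Finset.mul_sum]
  exact Finset.sum_comm

lemma prod_clockWeight_nonneg {r : ι → ℝ} (hr : ∀ i, 0 ≤ r i) (ω : ι → Bool) :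
    0 ≤ ∏ i, clockWeight (r i) (ω i) :=
  Finset.prod_nonneg fun i _ => clockWeight_nonneg (hr i) _

lemma clockExp_mono_of_weight {r : ι → ℝ} (hr : ∀ i, 0 ≤ r i) {g h : (ι → Bool) → ℝ}
    (H : ∀ ω, (∏ i, clockWeight (r i) (ω i)) ≠ 0 → g ω ≤ h ω) : clockExp r g ≤ clockExp r h := by
  refine Finset.sum_le_sum fun ω _ => ?_
  by_cases h0 : (∏ i, clockWeight (r i) (ω i)) = 0
  · simp [h0]
  · exact mul_le_mul_of_nonneg_left (H ω h0) (prod_clockWeight_nonneg hr ω)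

lemma clockExp_mono {r : ι → ℝ} (hr : ∀ i, 0 ≤ r i) {g h : (ι → Bool) → ℝ}
    (H : ∀ ω, g ω ≤ h ω) : clockExp r g ≤ clockExp r h :=
  clockExp_mono_of_weight hr fun ω _ => H ω

lemma clockExp_nonneg {r : ι → ℝ} (hr : ∀ i, 0 ≤ r i) {g : (ι → Bool) → ℝ}
    (H : ∀ ω, 0 ≤ g ω) : 0 ≤ clockExp r g :=
  Finset.sum_nonneg fun ω _ => mul_nonneg (prod_clockWeight_nonneg hr ω) (H ω)

lemma sum_eq_sum_half_update (i : ι) (f : (ι → Bool) → ℝ) :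
    ∑ ω, f ω = ∑ ω, (f (Function.update ω i true) + f (Function.update ω i false)) / 2 := by
  have hinv : Function.Involutive (fun ω : ι → Bool => Function.update ω i (!ω i)) := by
    intro ω
    simp
  have h1 : ∑ ω, f ω = ∑ ω, f (Function.update ω i (!ω i)) :=
    (Equiv.sum_comp hinv.toPerm f).symm
  have h2 : ∀ ω : ι → Bool, f ω + f (Function.update ω i (!ω i)) =
      f (Function.update ω i true) + f (Function.update ω i false) := by
    intro ω
    have h3 : Function.update ω i (ω i) = ω := Function.update_eq_self i ω
    cases h : ω i
    · rw [h] at h3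
      rw [h3]; simp [add_comm]
    · rw [h] at h3
      rw [h3]; simp
  rw [← Finset.sum_div, ← Finset.sum_congr rfl (fun ω _ => h2 ω), Finset.sum_add_distrib, ← h1]
  ring

lemma prod_erase_update (r : ι → ℝ) (i : ι) (ω : ι → Bool) (b : Bool) :
    ∏ j ∈ Finset.univ.erase i, clockWeight (r j) (Function.update ω i b j) =
      ∏ j ∈ Finset.univ.erase i, clockWeight (r j) (ω j) := by
  refine Finset.prod_congr rfl fun j hj => ?_
  rw [Function.update_of_ne (Finset.ne_of_mem_erase hj)]

lemma prod_clockWeight_update (r : ι → ℝ) (i : ι) (ω : ι → Bool) (b : Bool) :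
    ∏ j, clockWeight (r j) (Function.update ω i b j) =
      clockWeight (r i) b * ∏ j ∈ Finset.univ.erase i, clockWeight (r j) (ω j) := by
  rw [← Finset.mul_prod_erase Finset.univ _ (Finset.mem_univ i), prod_erase_update]
  simp

/-- Expectation computed by first averaging over the coordinate `i`. -/
lemma clockExp_eq_sum_erase (r : ι → ℝ) (i : ι) (g : (ι → Bool) → ℝ) :
    clockExp r g = ∑ ω, (∏ j ∈ Finset.univ.erase i, clockWeight (r j) (ω j)) *
      (((1 - Real.exp (-r i)) * g (Function.update ω i true) +
        Real.exp (-r i) * g (Function.update ω i false)) / 2) := by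
  unfold clockExp
  rw [sum_eq_sum_half_update i]
  refine Finset.sum_congr rfl fun ω _ => ?_
  rw [prod_clockWeight_update, prod_clockWeight_update]
  simp only [clockWeight, if_true, Bool.false_eq_true, if_false]
  ring

/-- By the product rule, raising the rate at `i` contributes exp(-r i) times the mean of g(on) -
g(off). The update difference already vanishes where `i` is on, so its plain expectation carries
exactly this factor. -/
lemma hasDerivAt_clockExp (a b : ι → ℝ) (g : (ι → Bool) → ℝ) (t : ℝ) :
    HasDerivAt (fun t => clockExp (fun i => a i + t * b i) g)
      (∑ i, b i * clockExp (fun i => a i + t * b i)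
        (fun ω => g (Function.update ω i true) - g ω)) t := by
  set r : ι → ℝ := fun i => a i + t * b i with hr
  have hlin : ∀ i, HasDerivAt (fun t => Real.exp (-(a i + t * b i)))
      (-(b i * Real.exp (-r i))) t := by
    intro i
    have h := (((hasDerivAt_id' t).mul_const (b i)).const_add (a i)).fun_neg.exp
    refine h.congr_deriv ?_
    ring
  have hw : ∀ i (β : Bool), HasDerivAt (fun t => clockWeight (a i + t * b i) β)
      ((if β = true then 1 else -1) * (b i * Real.exp (-r i))) t := by
    intro i β
    cases β
    · simpa [clockWeight] using hlin i
    · simpa [clockWeight] using (hlin i).const_sub 1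
  have hprod : ∀ ω : ι → Bool, HasDerivAt
      (fun t => (∏ i, clockWeight (a i + t * b i) (ω i)) * g ω)
      ((∑ i, (∏ j ∈ Finset.univ.erase i, clockWeight (r j) (ω j)) *
        ((if ω i = true then 1 else -1) * (b i * Real.exp (-r i)))) * g ω) t := by
    intro ω
    have h := HasDerivAt.fun_finsetProd (u := Finset.univ) (fun i _ => hw i (ω i))
    simp only [smul_eq_mul] at h
    exact h.mul_const (g ω)
  have hsum := HasDerivAt.fun_sum (u := Finset.univ) fun ω _ => hprod ω
  unfold clockExp
  refine hsum.congr_deriv ?_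
  simp only [Finset.sum_mul]
  rw [Finset.sum_comm]
  refine Finset.sum_congr rfl fun i _ => ?_
  have h1 := clockExp_eq_sum_erase r i (fun ω => g (Function.update ω i true) - g ω)
  unfold clockExp at h1
  rw [h1, sum_eq_sum_half_update i, Finset.mul_sum]
  refine Finset.sum_congr rfl fun ω _ => ?_
  rw [prod_erase_update, prod_erase_update]
  simp
  ring

/-- If every rate is nondecreasing along the path and `g` does not decrease when a coordinate is
switched on, then its expectation does not decrease. -/
lemma clockExp_le_clockExp {r s : ι → ℝ} (hr : ∀ i, 0 ≤ r i) (hrs : ∀ i, r i ≤ s i)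
    {g : (ι → Bool) → ℝ} (hg : ∀ ω i, g ω ≤ g (Function.update ω i true)) :
    clockExp r g ≤ clockExp s g := by
  have hd := fun t => hasDerivAt_clockExp r (fun i => s i - r i) g t
  have hmono : MonotoneOn (fun t => clockExp (fun i => r i + t * (s i - r i)) g)
      (Set.Icc 0 1) := by
    refine monotoneOn_of_deriv_nonneg (convex_Icc 0 1)
      (fun t _ => (hd t).continuousAt.continuousWithinAt)
      (fun t _ => (hd t).differentiableAt.differentiableWithinAt) ?_
    intro t ht
    rw [interior_Icc] at ht
    rw [(hd t).deriv]
    refine Finset.sum_nonneg fun i _ => mul_nonneg (sub_nonneg.2 (hrs i)) ?_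
    refine clockExp_nonneg (fun j => ?_) fun ω => sub_nonneg.2 (hg ω i)
    exact add_nonneg (hr j) (mul_nonneg ht.1.le (sub_nonneg.2 (hrs j)))
  simpa using hmono (Set.left_mem_Icc.2 zero_le_one) (Set.right_mem_Icc.2 zero_le_one) zero_le_one

lemma clockExp_mul_indicator (r : ι → ℝ) (i : ι) (g : (ι → Bool) → ℝ) :
    clockExp r (fun ω => g ω * (if ω i = true then 1 else 0)) =
      (1 - Real.exp (-r i)) * clockExp r (fun ω => g (Function.update ω i true)) := by
  rw [clockExp_eq_sum_erase r i, clockExp_eq_sum_erase r i, Finset.mul_sum]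
  refine Finset.sum_congr rfl fun ω _ => ?_
  simp
  ring

lemma clockExp_sq_le (r : ι → ℝ) (hr : ∀ i, 0 ≤ r i) (g : (ι → Bool) → ℝ) :
    clockExp r g ^ 2 ≤ clockExp r (fun ω => g ω ^ 2) := by
  have h : 0 ≤ clockExp r (fun ω => (g ω - clockExp r g) ^ 2) :=
    clockExp_nonneg hr fun ω => sq_nonneg _
  have h2 : clockExp r (fun ω => (g ω - clockExp r g) ^ 2) =
      clockExp r (fun ω => g ω ^ 2) - clockExp r g ^ 2 := by
    have : (fun ω => (g ω - clockExp r g) ^ 2) =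
        fun ω => (g ω ^ 2 - (2 * clockExp r g) * g ω) + clockExp r g ^ 2 := by
      funext ω; ring
    rw [this, clockExp_add, clockExp_sub, clockExp_mul_left, clockExp_const]
    ring
  linarith

/-- The centred and normalised indicator of the coordinate `i`. -/
noncomputable def score (r : ι → ℝ) (i : ι) (ω : ι → Bool) : ℝ :=
  1 - (1 - Real.exp (-r i))⁻¹ * (if ω i = true then 1 else 0)

/-- The indicator divided by its probability conditions coordinate `i` to be on, so pairing with the
score computes the influence of `i`. -/
lemma clockExp_mul_score {r : ι → ℝ} {i : ι} (hi : 0 < r i) (g : (ι → Bool) → ℝ) :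
    clockExp r (fun ω => g ω * score r i ω) =
      clockExp r (fun ω => g ω - g (Function.update ω i true)) := by
  have hp : 1 - Real.exp (-r i) ≠ 0 := by
    have : Real.exp (-r i) < 1 := by rw [Real.exp_lt_one_iff]; linarith
    linarith
  have : (fun ω => g ω * score r i ω) = fun ω => g ω - (1 - Real.exp (-r i))⁻¹ *
      (g ω * (if ω i = true then 1 else 0)) := by
    funext ω; simp only [score]; ring
  rw [this, clockExp_sub, clockExp_sub, clockExp_mul_left, clockExp_mul_indicator,
    inv_mul_cancel_left₀ hp]

/-- Scores of distinct coordinates are centred and independent, hence orthogonal. The diagonal value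
is 1/p - 1. -/
lemma clockExp_score_mul_score {r : ι → ℝ} {i j : ι} (hi : 0 < r i) :
    clockExp r (fun ω => score r j ω * score r i ω) =
      if i = j then (1 - Real.exp (-r i))⁻¹ - 1 else 0 := by
  rw [clockExp_mul_score hi]
  split_ifs with h
  · subst h
    have hp : 1 - Real.exp (-r i) ≠ 0 := by
      have : Real.exp (-r i) < 1 := by rw [Real.exp_lt_one_iff]; linarith
      linarith
    have h2 : (fun ω => score r i ω - score r i (Function.update ω i true)) =
        fun ω : ι → Bool => (1 - Real.exp (-r i))⁻¹ -
          (1 - Real.exp (-r i))⁻¹ * ((fun _ => (1 : ℝ)) ω * (if ω i = true then 1 else 0)) := by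
      funext ω; simp [score]
    rw [h2, clockExp_sub, clockExp_mul_left, clockExp_const, clockExp_mul_indicator, clockExp_const]
    field_simp
  · have h2 : (fun ω => score r j ω - score r j (Function.update ω i true)) = fun _ => (0 : ℝ) := by
      funext ω
      have : Function.update ω i true j = ω j := Function.update_of_ne (Ne.symm h) _ _
      simp [score, this]
    rw [h2, clockExp_const]

/-- The total influence of a family of coordinates with a common rate on a bounded function is at
most of the order of the square root of the size of the family. -/
lemma sum_clockExp_sub_update_le {r : ι → ℝ} (hr : ∀ i, 0 ≤ r i) {g : (ι → Bool) → ℝ} {B : ℝ}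
    (hB : 0 ≤ B) (hg : ∀ ω, |g ω| ≤ B) (S : Finset ι) {ρ : ℝ} (hρ : 0 < ρ) (hS : ∀ i ∈ S, r i = ρ) :
    ∑ i ∈ S, clockExp r (fun ω => g ω - g (Function.update ω i true)) ≤
      B * Real.sqrt (S.card / (1 - Real.exp (-ρ))) := by
  -- The total influence is the correlation of `g` with the sum of the scores. Orthogonality makes
  -- the second moment of that sum additive, which gives the square root.
  have h1 : ∑ i ∈ S, clockExp r (fun ω => g ω - g (Function.update ω i true)) =
      clockExp r (fun ω => g ω * ∑ i ∈ S, score r i ω) := by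
    simp only [Finset.mul_sum]
    rw [clockExp_sum]
    exact Finset.sum_congr rfl fun i hi => (clockExp_mul_score (by rw [hS i hi]; exact hρ) g).symm
  have hvar : clockExp r (fun ω => (∑ i ∈ S, score r i ω) ^ 2) ≤ S.card / (1 - Real.exp (-ρ)) := by
    have : (fun ω => (∑ i ∈ S, score r i ω) ^ 2) =
        fun ω => ∑ j ∈ S, ∑ i ∈ S, score r j ω * score r i ω := by
      funext ω; rw [sq, Finset.sum_mul_sum]
    rw [this, clockExp_sum]
    have h2 : ∀ j ∈ S, clockExp r (fun ω => ∑ i ∈ S, score r j ω * score r i ω) =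
        (1 - Real.exp (-ρ))⁻¹ - 1 := by
      intro j hj
      rw [clockExp_sum, Finset.sum_congr rfl
        (fun i hi => clockExp_score_mul_score (j := j) (by rw [hS i hi]; exact hρ))]
      rw [Finset.sum_ite_eq' S j]
      simp [hj, hS j hj]
    rw [Finset.sum_congr rfl h2, Finset.sum_const, nsmul_eq_mul, div_eq_mul_inv]
    gcongr
    linarith
  rw [h1]
  have h3 : clockExp r (fun ω => g ω * ∑ i ∈ S, score r i ω) ^ 2 ≤
      B ^ 2 * (S.card / (1 - Real.exp (-ρ))) := by
    refine (clockExp_sq_le r hr _).trans ?_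
    calc clockExp r (fun ω => (g ω * ∑ i ∈ S, score r i ω) ^ 2)
        ≤ clockExp r (fun ω => B ^ 2 * (∑ i ∈ S, score r i ω) ^ 2) := by
          refine clockExp_mono hr fun ω => ?_
          rw [mul_pow]
          exact mul_le_mul_of_nonneg_right (sq_le_sq' (abs_le.1 (hg ω)).1 (abs_le.1 (hg ω)).2)
            (sq_nonneg _)
      _ ≤ _ := by
          rw [clockExp_mul_left]
          exact mul_le_mul_of_nonneg_left hvar (sq_nonneg _)
  have h4 := Real.abs_le_sqrt h3
  rw [Real.sqrt_mul (sq_nonneg _), Real.sqrt_sq hB] at h4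
  exact (le_abs_self _).trans h4

/-- Marginalisation onto the coordinates in the range of an injection. -/
lemma clockExp_comp_embedding (e : κ ↪ ι) (r : ι → ℝ) (g : (κ → Bool) → ℝ) :
    clockExp r (fun ω => g (ω ∘ e)) = clockExp (r ∘ e) g := by
  classical
  let E : κ ⊕ {i // i ∉ Set.range e} ≃ ι :=
    (Equiv.sumCongr (Equiv.ofInjective e e.injective) (Equiv.refl _)).trans
      (Equiv.sumCompl (fun i => i ∈ Set.range e))
  have hEl : ∀ j, E (Sum.inl j) = e j := fun j => rfl
  let Φ : (ι → Bool) ≃ (κ → Bool) × ({i // i ∉ Set.range e} → Bool) :=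
    (Equiv.arrowCongr E.symm (Equiv.refl Bool)).trans (Equiv.sumArrowEquivProdArrow _ _ _)
  have hΦ1 : ∀ ω, (Φ ω).1 = ω ∘ e := fun ω => rfl
  have hΦ2 : ∀ ω j, (Φ ω).2 j = ω (E (Sum.inr j)) := fun ω j => rfl
  unfold clockExp
  let H : (κ → Bool) × ({i // i ∉ Set.range e} → Bool) → ℝ := fun x =>
    ((∏ j, clockWeight (r (e j)) (x.1 j)) * g x.1) *
      ∏ j, clockWeight (r (E (Sum.inr j))) (x.2 j)
  have hterm : ∀ ω : ι → Bool, (∏ i, clockWeight (r i) (ω i)) * g (ω ∘ e) = H (Φ ω) := by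
    intro ω
    simp only [H, hΦ1, hΦ2]
    rw [← Equiv.prod_comp E, Fintype.prod_sum_type]
    simp only [hEl, Function.comp]
    ring
  rw [Finset.sum_congr rfl (fun ω _ => hterm ω)]
  refine (Equiv.sum_comp Φ H).trans ?_
  rw [Fintype.sum_prod_type]
  refine Finset.sum_congr rfl fun ν _ => ?_
  simp only [H]
  rw [← Finset.mul_sum, sum_prod_clockWeight (fun j => r (E (Sum.inr j))), mul_one]
  rfl

end clockExp

/-! ### Binomial ratios compared with powers -/

section choose

lemma choose_div_choose_succ {m n k : ℕ} (hk : k < n) :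
    ((m.choose (k + 1) : ℝ) / n.choose (k + 1)) =
      (m.choose k / n.choose k) * (((m : ℝ) - k) / (n - k)) := by
  have h1 : (m.choose (k + 1) : ℝ) * (k + 1) = m.choose k * ((m : ℝ) - k) := by
    rcases le_or_gt k m with h | h
    · have := Nat.choose_succ_right_eq m k
      rw [← Nat.cast_sub h]
      exact_mod_cast this
    · simp [Nat.choose_eq_zero_of_lt h, Nat.choose_eq_zero_of_lt (h.trans (Nat.lt_succ_self k))]
  have h2 : (n.choose (k + 1) : ℝ) * (k + 1) = n.choose k * ((n : ℝ) - k) := by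
    have := Nat.choose_succ_right_eq n k
    rw [← Nat.cast_sub hk.le]
    exact_mod_cast this
  have h3 : (n.choose k : ℝ) ≠ 0 := by exact_mod_cast (Nat.choose_pos hk.le).ne'
  have h4 : (n.choose (k + 1) : ℝ) ≠ 0 := by exact_mod_cast (Nat.choose_pos hk).ne'
  have h5 : (n : ℝ) - k ≠ 0 := by
    have : (k : ℝ) < n := by exact_mod_cast hk
    linarith
  have h6 : (k : ℝ) + 1 ≠ 0 := by positivity
  rw [div_mul_div_comm, ← h1, ← h2]
  field_simp

lemma choose_div_choose_le_pow {m n : ℕ} (hmn : m ≤ n) (k : ℕ) (hk : k ≤ n) :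
    (m.choose k : ℝ) / n.choose k ≤ ((m : ℝ) / n) ^ k := by
  induction k with
  | zero => simp
  | succ k ih =>
    have hn : (0 : ℝ) < n := by exact_mod_cast (by omega : 0 < n)
    have hkn : (0 : ℝ) < n - k := by
      have : (k : ℝ) < n := by exact_mod_cast hk
      linarith
    have hmn' : (m : ℝ) ≤ n := by exact_mod_cast hmn
    rw [choose_div_choose_succ hk, pow_succ]
    have h1 : ((m : ℝ) - k) / (n - k) ≤ m / n := by
      rw [div_le_div_iff₀ hkn hn]
      nlinarith [Nat.cast_nonneg (α := ℝ) k]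
    exact (mul_le_mul_of_nonneg_left h1 (by positivity)).trans
      (mul_le_mul_of_nonneg_right (ih (by omega)) (by positivity))

/-- Each new factor of the binomial ratio is at least m/n - 2(k+1)/n, the 2 coming from n - (k+1) ≥
n/2. The losses add up to 2(1 + ... + k) = k(k+1). -/
lemma pow_le_choose_div_choose_add {m n : ℕ} (hmn : m ≤ n) (k : ℕ) (hk : 2 * k ≤ n) :
    ((m : ℝ) / n) ^ (k + 1) ≤
      (m.choose (k + 1) : ℝ) / n.choose (k + 1) + (k + 1) * k / n * ((m : ℝ) / n) ^ k := by
  induction k with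
  | zero => simp
  | succ k ih =>
    have hn : (0 : ℝ) < n := by exact_mod_cast (by omega : 0 < n)
    have hmn' : (m : ℝ) ≤ n := by exact_mod_cast hmn
    have hkn : (n : ℝ) ≤ 2 * (n - (k + 1 : ℕ)) := by
      have : 2 * ((k + 1 : ℕ) : ℝ) ≤ n := by exact_mod_cast hk
      linarith
    have hkn' : (0 : ℝ) < n - (k + 1 : ℕ) := by linarith
    have ih' := ih (by omega)
    have hu0 : (0 : ℝ) ≤ (m : ℝ) / n := by positivity
    have hle := choose_div_choose_le_pow hmn (k + 1) (by omega)
    have h1 : (m : ℝ) / n - 2 * (k + 1 : ℕ) / n ≤ ((m : ℝ) - (k + 1 : ℕ)) / (n - (k + 1 : ℕ)) := by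
      rw [← sub_div, div_le_div_iff₀ hn hkn']
      have : (0 : ℝ) ≤ (k + 1 : ℕ) := by positivity
      have hm : (0 : ℝ) ≤ m := by positivity
      nlinarith
    rw [choose_div_choose_succ (k := k + 1) (by omega)]
    set u : ℝ := (m : ℝ) / n with hu
    set f : ℝ := (m.choose (k + 1) : ℝ) / n.choose (k + 1) with hf
    have hf0 : 0 ≤ f := by positivity
    have h2 : f * (u - 2 * (k + 1 : ℕ) / n) ≤
        f * (((m : ℝ) - (k + 1 : ℕ)) / (n - (k + 1 : ℕ))) := mul_le_mul_of_nonneg_left h1 hf0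
    have h3 := mul_le_mul_of_nonneg_right ih' hu0
    have h4 : f * (2 * (k + 1 : ℕ) / n) ≤ u ^ (k + 1) * (2 * (k + 1 : ℕ) / n) :=
      mul_le_mul_of_nonneg_right hle (by positivity)
    have h5 : u ^ (k + 1 + 1) = u ^ (k + 1) * u := pow_succ _ _
    have h6 : (f + (k + 1) * k / n * u ^ k) * u = f * u + (k + 1) * k / n * u ^ (k + 1) := by ring
    have h7 : (((k + 1 : ℕ) : ℝ) + 1) * (k + 1 : ℕ) / n * u ^ (k + 1) =
        (k + 1) * k / n * u ^ (k + 1) + u ^ (k + 1) * (2 * (k + 1 : ℕ) / n) := by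
      push_cast; ring
    rw [h7, h5]
    linarith

/-- Split at u = 1/η: above it one more factor u costs at most η, and below it the power is at most
1/η. -/
lemma pow_le_mul_pow_succ_add {u η : ℝ} (hu : 0 ≤ u) (hη : 1 ≤ η) {k : ℕ} (hk : 1 ≤ k) :
    u ^ k ≤ η * u ^ (k + 1) + 1 / η := by
  have hη0 : 0 < η := by linarith
  rcases le_or_gt (1 / η) u with h | h
  · have h1 : 1 ≤ η * u := by
      rw [div_le_iff₀ hη0] at h; linarith
    have : u ^ k ≤ η * u ^ (k + 1) := by
      rw [pow_succ]; nlinarith [pow_nonneg hu k]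
    have : 0 < 1 / η := by positivity
    linarith
  · have h1 : u ≤ 1 := h.le.trans ((div_le_one hη0).2 hη)
    have h2 : u ^ k ≤ u ^ 1 := pow_le_pow_of_le_one hu h1 hk
    have h3 : 0 ≤ η * u ^ (k + 1) := by positivity
    rw [pow_one] at h2
    linarith

/-- An additive error of order 1/n is too large: multiplied by order n clauses and a logarithm of
order n it is linear in n. Most of it is therefore turned into a multiplicative factor, leaving an
additive part smaller by 1/η. -/
lemma pow_le_one_add_mul_choose_div_choose {m n k : ℕ} (hmn : m ≤ n) (hk1 : 1 ≤ k)
    (hk : 2 * k ≤ n) {b η : ℝ} (hb : (k : ℝ) ^ 2 / n ≤ b) (hη : 1 ≤ η) (hbη : b * η ≤ 1 / 2) :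
    ((m : ℝ) / n) ^ k ≤ (1 + 2 * b * η) * ((m.choose k : ℝ) / n.choose k) + 2 * b / η := by
  obtain ⟨k, rfl⟩ := Nat.exists_eq_add_of_le' hk1
  have hn : (0 : ℝ) < n := by exact_mod_cast (by omega : 0 < n)
  have hη0 : 0 < η := by linarith
  have hb0 : 0 ≤ b := le_trans (by positivity) hb
  have h1 := pow_le_choose_div_choose_add hmn k (by omega)
  set u : ℝ := (m : ℝ) / n with hu
  set f : ℝ := (m.choose (k + 1) : ℝ) / n.choose (k + 1) with hf
  have hu0 : 0 ≤ u := by positivity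
  have hf0 : 0 ≤ f := by positivity
  have h2 : ((k : ℝ) + 1) * k / n * u ^ k ≤ b * (η * u ^ (k + 1) + 1 / η) := by
    rcases Nat.eq_zero_or_pos k with h | h
    · subst h
      simp only [Nat.cast_zero, mul_zero, zero_div, zero_mul]
      positivity
    · refine mul_le_mul ?_ (pow_le_mul_pow_succ_add hu0 hη h) (by positivity) hb0
      refine le_trans ?_ hb
      gcongr
      push_cast
      nlinarith [Nat.cast_nonneg (α := ℝ) k]
  have h3 : u ^ (k + 1) * (1 - b * η) ≤ f + b / η := by
    have : b * (η * u ^ (k + 1) + 1 / η) = b * η * u ^ (k + 1) + b / η := by ring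
    nlinarith
  have h4 : 1 ≤ (1 - b * η) * (1 + 2 * b * η) := by
    have : 0 ≤ b * η := by positivity
    nlinarith
  have h5 : 0 ≤ 1 + 2 * b * η := by positivity
  have h6 : u ^ (k + 1) ≤ (1 + 2 * b * η) * (f + b / η) := by
    calc u ^ (k + 1) ≤ u ^ (k + 1) * ((1 - b * η) * (1 + 2 * b * η)) :=
          le_mul_of_one_le_right (by positivity) h4
      _ = (1 + 2 * b * η) * (u ^ (k + 1) * (1 - b * η)) := by ring
      _ ≤ _ := mul_le_mul_of_nonneg_left h3 h5
  have h7 : (1 + 2 * b * η) * (b / η) ≤ 2 * b / η := by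
    have : 1 + 2 * b * η ≤ 2 := by nlinarith
    calc (1 + 2 * b * η) * (b / η) ≤ 2 * (b / η) :=
          mul_le_mul_of_nonneg_right this (by positivity)
      _ = _ := by ring
  linarith [mul_add (1 + 2 * b * η) f (b / η)]

/-- Approximate convexity of the probability that a random `k`-subset lies in a given set, for a
ground set split into two blocks. -/
lemma choose_add_div_choose_add_le {m₁ m₂ n₁ n₂ k : ℕ} (h₁ : m₁ ≤ n₁) (h₂ : m₂ ≤ n₂) (hk1 : 1 ≤ k)
    (hk₁ : 2 * k ≤ n₁) (hk₂ : 2 * k ≤ n₂) {b η : ℝ} (hb₁ : (k : ℝ) ^ 2 / n₁ ≤ b)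
    (hb₂ : (k : ℝ) ^ 2 / n₂ ≤ b) (hη : 1 ≤ η) (hbη : b * η ≤ 1 / 2) :
    ((m₁ + m₂).choose k : ℝ) / (n₁ + n₂).choose k ≤
      (1 + 2 * b * η) * ((n₁ : ℝ) / (n₁ + n₂) * ((m₁.choose k : ℝ) / n₁.choose k)
        + (n₂ : ℝ) / (n₁ + n₂) * ((m₂.choose k : ℝ) / n₂.choose k)) + 2 * b / η := by
  have hn₁ : (0 : ℝ) < n₁ := by exact_mod_cast (by omega : 0 < n₁)
  have hn₂ : (0 : ℝ) < n₂ := by exact_mod_cast (by omega : 0 < n₂)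
  have e₁ := pow_le_one_add_mul_choose_div_choose h₁ hk1 hk₁ hb₁ hη hbη
  have e₂ := pow_le_one_add_mul_choose_div_choose h₂ hk1 hk₂ hb₂ hη hbη
  have e₀ := choose_div_choose_le_pow (add_le_add h₁ h₂) k (by omega)
  have hsum : (n₁ : ℝ) / (n₁ + n₂) + (n₂ : ℝ) / (n₁ + n₂) = 1 := by
    field_simp
  have hx₁ : (m₁ : ℝ) / n₁ ∈ Set.Ici (0 : ℝ) := Set.mem_Ici.2 (by positivity)
  have hx₂ : (m₂ : ℝ) / n₂ ∈ Set.Ici (0 : ℝ) := Set.mem_Ici.2 (by positivity)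
  have ha : 0 ≤ (n₁ : ℝ) / (n₁ + n₂) := by positivity
  have hb : 0 ≤ (n₂ : ℝ) / (n₁ + n₂) := by positivity
  have hconv := (convexOn_pow k).2 hx₁ hx₂ ha hb hsum
  simp only [smul_eq_mul] at hconv
  have heq : (n₁ : ℝ) / (n₁ + n₂) * (m₁ / n₁) + (n₂ : ℝ) / (n₁ + n₂) * (m₂ / n₂) =
      ((m₁ + m₂ : ℕ) : ℝ) / (n₁ + n₂ : ℕ) := by
    push_cast
    field_simp
  rw [heq] at hconv
  refine (e₀.trans hconv).trans ?_
  set l₁ : ℝ := (n₁ : ℝ) / (n₁ + n₂)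
  set l₂ : ℝ := (n₂ : ℝ) / (n₁ + n₂)
  have hl₁ : 0 ≤ l₁ := by positivity
  have hl₂ : 0 ≤ l₂ := by positivity
  have := add_le_add (mul_le_mul_of_nonneg_left e₁ hl₁) (mul_le_mul_of_nonneg_left e₂ hl₂)
  refine this.trans (le_of_eq ?_)
  linear_combination (2 * b / η) * hsum

end choose

/-! ### Power series of the logarithmic loss and tuples of solutions -/

section loss

open Classical in
/-- The decrease of `log (1 + |S|)` when the elements of `S` violating `c` are removed from `S`. -/
noncomputable def logLoss {V C : Type*} (viol : V → C → Prop) (S : Finset V) (c : C) : ℝ :=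
  Real.log (1 + S.card) - Real.log (1 + (S.filter fun x => ¬ viol x c).card)

variable {V C : Type*} (viol : V → C → Prop)

lemma logLoss_nonneg (S : Finset V) (c : C) : 0 ≤ logLoss viol S c := by
  classical
  unfold logLoss
  rw [sub_nonneg]
  refine Real.log_le_log (by positivity) ?_
  have := Finset.card_filter_le S fun x => ¬ viol x c
  gcongr

-- This is the series of -log(1-x) at the violated fraction x; the regularising 1 in the denominator
-- keeps x < 1.
open Classical in
lemma hasSum_logLoss (S : Finset V) (c : C) :
    HasSum (fun j : ℕ => (((S.filter fun x => viol x c).card : ℝ) / (1 + S.card)) ^ (j + 1) /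
      (j + 1)) (logLoss viol S c) := by
  have hcard : ((S.filter fun x => viol x c).card : ℝ) +
      (S.filter fun x => ¬ viol x c).card = S.card := by
    exact_mod_cast Finset.card_filter_add_card_filter_not (fun x => viol x c)
  have hpos : (0 : ℝ) < 1 + S.card := by positivity
  have hlt : |((S.filter fun x => viol x c).card : ℝ) / (1 + S.card)| < 1 := by
    rw [abs_of_nonneg (by positivity), div_lt_one hpos]
    have : (0 : ℝ) ≤ (S.filter fun x => ¬ viol x c).card := by positivity
    linarith
  have h := Real.hasSum_pow_div_log_of_abs_lt_one hlt
  convert h using 1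
  unfold logLoss
  have : 1 - ((S.filter fun x => viol x c).card : ℝ) / (1 + S.card) =
      (1 + (S.filter fun x => ¬ viol x c).card) / (1 + S.card) := by
    field_simp
    linarith
  rw [this, Real.log_div (by positivity) (by positivity)]
  ring

/-- The case of a clause violated by everything. It sums the contributions of a constant error δ per
tuple in `sum_logLoss_le`. -/
lemma hasSum_log_one_add_card (S : Finset V) :
    HasSum (fun j : ℕ => ((S.card : ℝ) / (1 + S.card)) ^ (j + 1) / (j + 1))
      (Real.log (1 + S.card)) := by
  classical
  have h := hasSum_logLoss (C := Unit) (fun _ _ => True) S ()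
  simpa [logLoss] using h

-- Expanding the power turns it into a count over j-tuples of assignments, after which the sums over
-- clauses and tuples are exchanged.
open Classical in
lemma sum_card_filter_pow (S : Finset V) (A : Finset C) (j : ℕ) :
    ∑ c ∈ A, ((S.filter fun x => viol x c).card : ℝ) ^ j =
      ∑ x ∈ Fintype.piFinset (fun _ : Fin j => S),
        ((A.filter fun c => ∀ i, viol (x i) c).card : ℝ) := by
  have h1 : ∀ c, ((S.filter fun x => viol x c).card : ℝ) ^ j =
      ∑ x ∈ Fintype.piFinset (fun _ : Fin j => S), if ∀ i, viol (x i) c then (1 : ℝ) else 0 := by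
    intro c
    have := Finset.prod_univ_sum (fun _ : Fin j => S)
      (fun _ x => if viol x c then (1 : ℝ) else 0)
    simp only [Finset.prod_const, Finset.card_univ, Fintype.card_fin, Finset.sum_boole] at this
    rw [this]
    refine Finset.sum_congr rfl fun x _ => ?_
    rw [Finset.prod_boole]
    simp
  simp only [h1]
  rw [Finset.sum_comm]
  refine Finset.sum_congr rfl fun x _ => ?_
  rw [Finset.sum_boole]

open Classical in
/-- A comparison of the numbers of clauses violated by all members of a tuple of assignments gives
a comparison of total losses. -/
lemma sum_logLoss_le (S : Finset V) {A A₁ A₂ : Finset C} {w w₁ w₂ δ : ℝ}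
    (H : ∀ (j : ℕ) (x : Fin (j + 1) → V), w * (A.filter fun c => ∀ i, viol (x i) c).card ≤
      w₁ * (A₁.filter fun c => ∀ i, viol (x i) c).card +
      w₂ * (A₂.filter fun c => ∀ i, viol (x i) c).card + δ) :
    w * ∑ c ∈ A, logLoss viol S c ≤
      w₁ * ∑ c ∈ A₁, logLoss viol S c + w₂ * ∑ c ∈ A₂, logLoss viol S c +
        δ * Real.log (1 + S.card) := by
  have hs : ∀ (B : Finset C), HasSum (fun j : ℕ => ∑ c ∈ B,
      (((S.filter fun x => viol x c).card : ℝ) / (1 + S.card)) ^ (j + 1) / (j + 1))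
      (∑ c ∈ B, logLoss viol S c) := fun B => hasSum_sum fun c _ => hasSum_logLoss viol S c
  have hL := (hs A).mul_left w
  have hR := (((hs A₁).mul_left w₁).add ((hs A₂).mul_left w₂)).add
    ((hasSum_log_one_add_card S).mul_left δ)
  -- The comparison is made for each power of the violated fraction and then for each tuple, where
  -- it is the hypothesis `H`.
  refine hasSum_le (fun j => ?_) hL hR
  have hq : ∀ B : Finset C, ∑ c ∈ B,
      (((S.filter fun x => viol x c).card : ℝ) / (1 + S.card)) ^ (j + 1) / (j + 1) =
      (∑ x ∈ Fintype.piFinset (fun _ : Fin (j + 1) => S),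
        ((B.filter fun c => ∀ i, viol (x i) c).card : ℝ)) *
        ((1 / (1 + S.card)) ^ (j + 1) / (j + 1)) := by
    intro B
    rw [← sum_card_filter_pow, Finset.sum_mul]
    refine Finset.sum_congr rfl fun c _ => ?_
    rw [div_pow, div_pow]
    ring
  have hq' : ((S.card : ℝ) / (1 + S.card)) ^ (j + 1) / (j + 1) =
      (∑ x ∈ Fintype.piFinset (fun _ : Fin (j + 1) => S), (1 : ℝ)) *
        ((1 / (1 + S.card)) ^ (j + 1) / (j + 1)) := by
    simp only [Finset.sum_const, Fintype.card_piFinset, Finset.prod_const, Finset.card_univ,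
      Fintype.card_fin, nsmul_eq_mul, Nat.cast_pow, mul_one]
    rw [div_pow, div_pow]
    ring
  rw [hq, hq, hq, hq', ← mul_assoc, ← mul_assoc, ← mul_assoc, ← mul_assoc, ← add_mul, ← add_mul]
  refine mul_le_mul_of_nonneg_right ?_ (by positivity)
  rw [Finset.mul_sum, Finset.mul_sum, Finset.mul_sum, Finset.mul_sum, ← Finset.sum_add_distrib,
    ← Finset.sum_add_distrib]
  refine Finset.sum_le_sum fun x _ => ?_
  rw [mul_one]
  exact H j x

end loss

/-! ### Clauses, solution sets and blocks of variables -/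

noncomputable instance instFintypeClause (k n : ℕ) : Fintype (Clause k n) := Fintype.ofFinite _

section clause

variable {k n a b : ℕ}

/-- The assignment `x` makes every literal of the clause `c` false. -/
def Violates (x : Fin n → Bool) (c : Clause k n) : Prop := ∀ l ∈ c.1, x l.1 ≠ l.2

/-- The formula whose clauses are marked by `ω`. -/
def toFormula (ω : Clause k n → Bool) : Formula k n := {c | ω c = true}

open Classical in
/-- The satisfying assignments of the formula marked by `ω`. -/
noncomputable def sols (ω : Clause k n → Bool) : Finset (Fin n → Bool) :=
  Finset.univ.filter fun x => Satisfies x (toFormula ω)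

lemma mem_sols {ω : Clause k n → Bool} {x : Fin n → Bool} :
    x ∈ sols ω ↔ ∀ c, ω c = true → ¬ Violates x c := by
  classical
  rw [sols, Finset.mem_filter]
  simp only [Finset.mem_univ, true_and, Satisfies, toFormula, Violates, Set.mem_ofPred_eq]
  push Not
  rfl

lemma Z_toFormula (ω : Clause k n → Bool) : Z (toFormula ω) = (sols ω).card := by
  classical
  rw [Z, ← Set.ncard_coe_finset]
  congr 1
  ext x
  simp [sols]

lemma card_sols_le (ω : Clause k n → Bool) : (sols ω).card ≤ 2 ^ n := by
  have := Finset.card_le_univ (sols ω)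
  simpa using this

open Classical in
lemma sols_update (ω : Clause k n → Bool) (c : Clause k n) :
    sols (Function.update ω c true) = (sols ω).filter fun x => ¬ Violates x c := by
  ext x
  simp only [mem_sols, Finset.mem_filter]
  constructor
  · intro h
    refine ⟨fun d hd => h d ?_, h c (by simp)⟩
    by_cases hdc : d = c
    · subst hdc; simp
    · rw [Function.update_of_ne hdc]; exact hd
  · rintro ⟨h, hc⟩ d hd
    by_cases hdc : d = c
    · subst hdc; exact hc
    · rw [Function.update_of_ne hdc] at hd
      exact h d hd

/-- The regularised logarithm of the number of satisfying assignments. -/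
noncomputable def logSols (ω : Clause k n → Bool) : ℝ := Real.log (1 + (sols ω).card)

lemma logSols_nonneg (ω : Clause k n → Bool) : 0 ≤ logSols ω :=
  Real.log_nonneg (by simp)

lemma logSols_le (ω : Clause k n → Bool) : logSols ω ≤ n + 1 := by
  have h1 : (1 : ℝ) + (sols ω).card ≤ 2 ^ (n + 1) := by
    have h2 : ((sols ω).card : ℝ) ≤ 2 ^ n := by exact_mod_cast card_sols_le ω
    have h3 : (1 : ℝ) ≤ 2 ^ n := one_le_pow₀ (by norm_num)
    rw [pow_succ]; linarith
  have h4 : logSols ω ≤ Real.log (2 ^ (n + 1)) := Real.log_le_log (by positivity) h1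
  rw [Real.log_pow] at h4
  refine h4.trans ?_
  push_cast
  nlinarith [Real.log_two_lt_d9, Nat.cast_nonneg (α := ℝ) n]

lemma logSols_sub_update (ω : Clause k n → Bool) (c : Clause k n) :
    logSols ω - logSols (Function.update ω c true) = logLoss Violates (sols ω) c := by
  classical
  rw [logSols, logSols, logLoss, sols_update]

open Classical in
/-- The clauses violated by all members of a tuple of assignments correspond to the `k`-sets of
variables on which all members agree. -/
lemma card_filter_violates {j : ℕ} (x : Fin (j + 1) → Fin n → Bool) :
    ((Finset.univ : Finset (Clause k n)).filter fun c => ∀ i, Violates (x i) c).card =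
      ((Finset.univ : Finset (Fin n)).filter fun v => ∀ i, x i v = x 0 v).card.choose k := by
  rw [← Finset.card_powersetCard]
  symm
  -- On a set of variables where the tuple agrees, exactly one clause is violated by all members:
  -- the one made of the literals false under the common values.
  let e : Fin n ↪ Literal n := ⟨fun v => (v, !x 0 v), fun v w h => (Prod.ext_iff.1 h).1⟩
  have he : ∀ v, e v = (v, !x 0 v) := fun _ => rfl
  refine Finset.card_bij (fun T hT => ⟨T.map e, ?_, ?_⟩) ?_ ?_ ?_
  · rw [Finset.card_map]; exact (Finset.mem_powersetCard.1 hT).2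
  · intro l hl l' hl' h
    simp only [Finset.coe_map, Set.mem_image, Finset.mem_coe] at hl hl'
    obtain ⟨v, -, rfl⟩ := hl
    obtain ⟨w, -, rfl⟩ := hl'
    have : v = w := h
    rw [this]
  · intro T hT
    rw [Finset.mem_filter]
    refine ⟨Finset.mem_univ _, fun i l hl => ?_⟩
    obtain ⟨v, hv, rfl⟩ := Finset.mem_map.1 hl
    have := (Finset.mem_filter.1 ((Finset.mem_powersetCard.1 hT).1 hv)).2 i
    simp [he, this]
  · intro T hT T' hT' h
    exact Finset.map_injective e (Subtype.ext_iff.1 h)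
  · intro c hc
    have hc' := (Finset.mem_filter.1 hc).2
    have hval : ∀ l ∈ c.1, ∀ i, x i l.1 = !l.2 := by
      intro l hl i
      have := hc' i l hl
      revert this
      cases x i l.1 <;> cases l.2 <;> simp
    have hmap : (c.1.image Prod.fst).map e = c.1 := by
      ext l
      simp only [Finset.mem_map, Finset.mem_image]
      constructor
      · rintro ⟨v, ⟨l', hl', rfl⟩, rfl⟩
        have : e l'.1 = l' := by
          refine Prod.ext rfl ?_
          simp [he, hval l' hl' 0]
        rwa [this]
      · intro hl
        refine ⟨l.1, ⟨l, hl, rfl⟩, Prod.ext rfl ?_⟩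
        simp [he, hval l hl 0]
    refine ⟨c.1.image Prod.fst, ?_, Subtype.ext hmap⟩
    rw [Finset.mem_powersetCard]
    constructor
    · intro v hv
      obtain ⟨l, hl, rfl⟩ := Finset.mem_image.1 hv
      rw [Finset.mem_filter]
      exact ⟨Finset.mem_univ _, fun i => by rw [hval l hl i, hval l hl 0]⟩
    · rw [Finset.card_image_of_injOn c.2.2]; exact c.2.1

/-- A clause is determined by its variables and the subset of them occurring positively. The
variance bound needs only this inequality. -/
lemma card_clause_le (k n : ℕ) : Fintype.card (Clause k n) ≤ n.choose k * 2 ^ k := by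
  classical
  have h : (((Finset.univ : Finset (Fin n)).powersetCard k).sigma
      (fun T => T.powerset)).card = n.choose k * 2 ^ k := by
    rw [Finset.card_sigma, Finset.sum_congr rfl (g := fun _ => 2 ^ k), Finset.sum_const,
      Finset.card_powersetCard]
    · simp
    · intro T hT
      rw [Finset.card_powerset, (Finset.mem_powersetCard.1 hT).2]
  rw [← h, ← Finset.card_univ]
  refine Finset.card_le_card_of_injOn
    (fun c : Clause k n => (⟨c.1.image Prod.fst, (c.1.filter fun l => l.2 = true).image Prod.fst⟩ :
      (_ : Finset (Fin n)) × Finset (Fin n))) ?_ ?_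
  · intro c _
    simp only [Finset.coe_sigma, Set.mem_sigma_iff, Finset.mem_coe, Finset.mem_powersetCard,
      Finset.subset_univ, true_and, Finset.mem_powerset]
    exact ⟨by rw [Finset.card_image_of_injOn c.2.2]; exact c.2.1,
      Finset.image_subset_image (Finset.filter_subset _ _)⟩
  · have key : ∀ c d : Clause k n, c.1.image Prod.fst = d.1.image Prod.fst →
        (c.1.filter fun l => l.2 = true).image Prod.fst =
          (d.1.filter fun l => l.2 = true).image Prod.fst → c.1 ⊆ d.1 := by
      intro c d h1 h2 l hl
      have hl1 : l.1 ∈ d.1.image Prod.fst := h1 ▸ Finset.mem_image_of_mem _ hl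
      obtain ⟨l', hl', hll'⟩ := Finset.mem_image.1 hl1
      have htrue : l.2 = true ↔ l'.2 = true := by
        constructor
        · intro ht
          have : l.1 ∈ (d.1.filter fun l => l.2 = true).image Prod.fst :=
            h2 ▸ Finset.mem_image.2 ⟨l, Finset.mem_filter.2 ⟨hl, ht⟩, rfl⟩
          obtain ⟨m, hm, hml⟩ := Finset.mem_image.1 this
          rw [Finset.mem_filter] at hm
          have : m = l' := d.2.2 hm.1 hl' (hml.trans hll'.symm)
          rw [← this]; exact hm.2
        · intro ht
          have : l'.1 ∈ (c.1.filter fun l => l.2 = true).image Prod.fst :=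
            h2.symm ▸ Finset.mem_image.2 ⟨l', Finset.mem_filter.2 ⟨hl', ht⟩, rfl⟩
          obtain ⟨m, hm, hml⟩ := Finset.mem_image.1 this
          rw [Finset.mem_filter] at hm
          have : m = l := c.2.2 hm.1 hl (hml.trans hll')
          rw [← this]; exact hm.2
      have : l = l' := Prod.ext hll'.symm (Bool.eq_iff_iff.2 htrue)
      rw [this]; exact hl'
    intro c _ d _ h
    have h1 := (Sigma.mk.inj_iff.1 h).1
    have h2 := eq_of_heq (Sigma.mk.inj_iff.1 h).2
    exact Subtype.ext (Finset.Subset.antisymm (key c d h1 h2) (key d c h1.symm h2.symm))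

/-- Renaming the variables of a clause along an injection. -/
def clauseMap (e : Fin a ↪ Fin n) : Clause k a ↪ Clause k n where
  toFun c := ⟨c.1.map (e.prodMap (Function.Embedding.refl Bool)), by
      rw [Finset.card_map]; exact c.2.1, by
    intro l hl l' hl' h
    simp only [Finset.coe_map, Set.mem_image, Finset.mem_coe] at hl hl'
    obtain ⟨m, hm, rfl⟩ := hl
    obtain ⟨m', hm', rfl⟩ := hl'
    rw [c.2.2 hm hm' (e.injective h)]⟩
  inj' c d h := Subtype.ext (Finset.map_injective _ (Subtype.ext_iff.1 h))

lemma violates_clauseMap (e : Fin a ↪ Fin n) (x : Fin n → Bool) (c : Clause k a) :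
    Violates x (clauseMap e c) ↔ Violates (x ∘ e) c := by
  change (∀ l ∈ c.1.map (e.prodMap (Function.Embedding.refl Bool)), x l.1 ≠ l.2) ↔ _
  rw [Finset.forall_mem_map]
  rfl

open Classical in
lemma card_filter_map_violates (e : Fin a ↪ Fin n) {j : ℕ} (x : Fin (j + 1) → Fin n → Bool) :
    ((Finset.univ.map (clauseMap (k := k) e)).filter fun c => ∀ i, Violates (x i) c).card =
      ((Finset.univ : Finset (Fin a)).filter fun v => ∀ i, x i (e v) = x 0 (e v)).card.choose k := by
  rw [Finset.filter_map, Finset.card_map]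
  have := card_filter_violates (k := k) (fun i => x i ∘ e)
  simp only [Function.comp_apply] at this
  rw [← this]
  congr 1
  ext c
  simp [violates_clauseMap]

open Classical in
lemma card_filter_agree_add {j : ℕ} (x : Fin (j + 1) → Fin (a + b) → Bool) :
    ((Finset.univ : Finset (Fin (a + b))).filter fun v => ∀ i, x i v = x 0 v).card =
      ((Finset.univ : Finset (Fin a)).filter fun v =>
        ∀ i, x i (Fin.castAddEmb b v) = x 0 (Fin.castAddEmb b v)).card +
      ((Finset.univ : Finset (Fin b)).filter fun v =>
        ∀ i, x i (Fin.natAddEmb a v) = x 0 (Fin.natAddEmb a v)).card := by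
  simp only [Finset.card_filter]
  rw [Fin.sum_univ_add]
  rfl

/-- A literal of the clause shows its block. For k = 0 the empty clause would belong to both blocks.
-/
lemma clauseMap_castAdd_ne_natAdd (hk : 1 ≤ k) (c : Clause k a) (d : Clause k b) :
    clauseMap (Fin.castAddEmb b) c ≠ clauseMap (Fin.natAddEmb a) d := by
  intro h
  have hne : c.1.Nonempty := Finset.card_pos.1 (by rw [c.2.1]; omega)
  obtain ⟨l, hl⟩ := hne
  have h1 : (Fin.castAddEmb b l.1, l.2) ∈ (clauseMap (Fin.castAddEmb b) c).1 :=
    Finset.mem_map.2 ⟨l, hl, rfl⟩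
  rw [h] at h1
  obtain ⟨m, -, hm⟩ := Finset.mem_map.1 h1
  have h2 : Fin.natAdd a m.1 = Fin.castAdd b l.1 := (Prod.ext_iff.1 hm).1
  have h3 := Fin.ext_iff.1 h2
  simp at h3
  omega

/-- If every clause involves only variables of one of two blocks, then assignments of the blocks can
be combined. -/
lemma card_sols_mul_le {ω : Clause k (a + b) → Bool}
    (hω : ∀ c, ω c = true → c ∈ Set.range (clauseMap (k := k) (Fin.castAddEmb (n := a) b)) ∨
      c ∈ Set.range (clauseMap (k := k) (Fin.natAddEmb (m := b) a))) :
    (sols (ω ∘ clauseMap (Fin.castAddEmb b))).card * (sols (ω ∘ clauseMap (Fin.natAddEmb a))).card ≤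
      (sols ω).card := by
  rw [← Finset.card_product]
  refine Finset.card_le_card_of_injOn (fun p => Fin.append p.1 p.2) ?_ ?_
  · intro p hp
    rw [Finset.mem_coe, Finset.mem_product] at hp
    rw [Finset.mem_coe, mem_sols]
    intro c hc
    rcases hω c hc with ⟨d, rfl⟩ | ⟨d, rfl⟩
    · rw [violates_clauseMap]
      have : Fin.append p.1 p.2 ∘ (Fin.castAddEmb b) = p.1 := by
        funext i; simp
      rw [this]
      exact mem_sols.1 hp.1 d hc
    · rw [violates_clauseMap]
      have : Fin.append p.1 p.2 ∘ (Fin.natAddEmb a) = p.2 := by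
        funext i; simp
      rw [this]
      exact mem_sols.1 hp.2 d hc
  · intro p _ q _ h
    have h' : Fin.appendEquiv a b p = Fin.appendEquiv a b q := h
    exact (Fin.appendEquiv a b).injective h'

end clause

/-! ### The interpolation inequality between a formula and two independent blocks -/

section interpolation

variable {k a b : ℕ}

/-- The clauses on the first block of variables. -/
noncomputable def leftClauses (k a b : ℕ) : Finset (Clause k (a + b)) :=
  Finset.univ.map (clauseMap (Fin.castAddEmb b))

/-- The clauses on the second block of variables. -/
noncomputable def rightClauses (k a b : ℕ) : Finset (Clause k (a + b)) :=
  Finset.univ.map (clauseMap (Fin.natAddEmb a))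

lemma disjoint_leftClauses_rightClauses (hk : 1 ≤ k) :
    Disjoint (leftClauses k a b) (rightClauses k a b) := by
  rw [Finset.disjoint_left]
  intro c hc hc'
  obtain ⟨d, -, rfl⟩ := Finset.mem_map.1 hc
  obtain ⟨d', -, h⟩ := Finset.mem_map.1 hc'
  exact clauseMap_castAdd_ne_natAdd hk d d' h.symm

/-- The heart of the interpolation. The agreement set of a tuple splits over the two blocks, and
approximate convexity of the binomial ratio applies to each tuple separately. -/
lemma sum_logLoss_univ_le (hk : 1 ≤ k) (ha : 2 * k ≤ a) (hb : 2 * k ≤ b) {β η : ℝ}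
    (hβa : (k : ℝ) ^ 2 / a ≤ β) (hβb : (k : ℝ) ^ 2 / b ≤ β) (hη : 1 ≤ η) (hβη : β * η ≤ 1 / 2)
    (S : Finset (Fin (a + b) → Bool)) :
    (1 / ((a + b).choose k : ℝ)) * ∑ c, logLoss Violates S (c : Clause k (a + b)) ≤
      ((1 + 2 * β * η) * ((a : ℝ) / (a + b)) / a.choose k) *
        ∑ c ∈ leftClauses k a b, logLoss Violates S c +
      ((1 + 2 * β * η) * ((b : ℝ) / (a + b)) / b.choose k) *
        ∑ c ∈ rightClauses k a b, logLoss Violates S c +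
      2 * β / η * Real.log (1 + S.card) := by
  classical
  refine sum_logLoss_le _ S fun j x => ?_
  rw [leftClauses, rightClauses, card_filter_map_violates, card_filter_map_violates,
    card_filter_violates, card_filter_agree_add]
  have h₁ := Finset.card_filter_le (Finset.univ : Finset (Fin a))
    fun v => ∀ i, x i (Fin.castAddEmb b v) = x 0 (Fin.castAddEmb b v)
  have h₂ := Finset.card_filter_le (Finset.univ : Finset (Fin b))
    fun v => ∀ i, x i (Fin.natAddEmb a v) = x 0 (Fin.natAddEmb a v)
  rw [Finset.card_univ, Fintype.card_fin] at h₁ h₂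
  have := choose_add_div_choose_add_le h₁ h₂ hk ha hb hβa hβb hη hβη
  refine le_trans (le_of_eq ?_) (this.trans (le_of_eq ?_))
  · ring
  · ring

/-- The rates of the model in which the two blocks of variables do not interact. -/
noncomputable def splitRate (k a b : ℕ) (ρ₁ ρ₂ : ℝ) (c : Clause k (a + b)) : ℝ :=
  (if c ∈ leftClauses k a b then ρ₁ else 0) + (if c ∈ rightClauses k a b then ρ₂ else 0)

lemma splitRate_of_mem_left (hk : 1 ≤ k) {ρ₁ ρ₂ : ℝ} {c : Clause k (a + b)}
    (hc : c ∈ leftClauses k a b) : splitRate k a b ρ₁ ρ₂ c = ρ₁ := by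
  simp [splitRate, hc, Finset.disjoint_left.1 (disjoint_leftClauses_rightClauses hk) hc]

lemma splitRate_of_mem_right (hk : 1 ≤ k) {ρ₁ ρ₂ : ℝ} {c : Clause k (a + b)}
    (hc : c ∈ rightClauses k a b) : splitRate k a b ρ₁ ρ₂ c = ρ₂ := by
  simp [splitRate, hc, Finset.disjoint_right.1 (disjoint_leftClauses_rightClauses hk) hc]

lemma splitRate_nonneg {ρ₁ ρ₂ : ℝ} (h₁ : 0 ≤ ρ₁) (h₂ : 0 ≤ ρ₂) (c : Clause k (a + b)) :
    0 ≤ splitRate k a b ρ₁ ρ₂ c := by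
  unfold splitRate
  split_ifs <;> linarith

/-- One clause may cost as much as n, by destroying all solutions, but the total-influence bound
makes the average much smaller. With `v` of order n, the mean per `k`-set is of order sqrt n. -/
lemma sum_clockExp_logLoss_le {n d : ℕ} (e : Fin d ↪ Fin n) {r : Clause k n → ℝ}
    (hr : ∀ c, 0 ≤ r c) {σ v : ℝ} (hσ : 0 < σ) (hv : 0 < v)
    (hvσ : v ≤ d.choose k * (1 - Real.exp (-σ)))
    (hrσ : ∀ c ∈ Finset.univ.map (clauseMap (k := k) e), r c = σ) :
    (∑ c ∈ Finset.univ.map (clauseMap (k := k) e),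
      clockExp r (fun ω => logLoss Violates (sols ω) c)) ≤
      d.choose k * ((n + 1) * Real.sqrt (2 ^ k / v)) := by
  have hexp : 0 < 1 - Real.exp (-σ) := by
    have : Real.exp (-σ) < 1 := by rw [Real.exp_lt_one_iff]; linarith
    linarith
  have hd : (0 : ℝ) < d.choose k := by
    by_contra h
    have : (d.choose k : ℝ) * (1 - Real.exp (-σ)) ≤ 0 :=
      mul_nonpos_of_nonpos_of_nonneg (not_lt.1 h) hexp.le
    linarith
  have h := sum_clockExp_sub_update_le hr (g := logSols) (B := (n : ℝ) + 1) (by positivity)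
    (fun ω => by rw [abs_of_nonneg (logSols_nonneg ω)]; exact logSols_le ω)
    (Finset.univ.map (clauseMap (k := k) e)) hσ hrσ
  simp only [logSols_sub_update] at h
  refine h.trans ?_
  rw [Finset.card_map, Finset.card_univ]
  have h2 : ((Fintype.card (Clause k d) : ℕ) : ℝ) / (1 - Real.exp (-σ)) ≤
      (d.choose k : ℝ) ^ 2 * (2 ^ k / v) := by
    have h3 : ((Fintype.card (Clause k d) : ℕ) : ℝ) ≤ d.choose k * 2 ^ k := by
      exact_mod_cast card_clause_le k d
    rw [div_le_iff₀ hexp]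
    calc ((Fintype.card (Clause k d) : ℕ) : ℝ) ≤ d.choose k * 2 ^ k := h3
      _ = (d.choose k * (2 ^ k / v)) * v := by field_simp
      _ ≤ (d.choose k * (2 ^ k / v)) * (d.choose k * (1 - Real.exp (-σ))) := by gcongr
      _ = _ := by ring
  calc ((n : ℝ) + 1) * Real.sqrt ((Fintype.card (Clause k d) : ℕ) / (1 - Real.exp (-σ)))
      ≤ ((n : ℝ) + 1) * Real.sqrt ((d.choose k : ℝ) ^ 2 * (2 ^ k / v)) := by gcongr
    _ = _ := by
      rw [Real.sqrt_mul (sq_nonneg _), Real.sqrt_sq hd.le]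
      ring

/-- The interpolation inequality between a random formula and two independent random formulas on
blocks of its variables. -/
lemma clockExp_splitRate_le (hk : 1 ≤ k) (ha : 2 * k ≤ a) (hb : 2 * k ≤ b) {β η : ℝ}
    (hβa : (k : ℝ) ^ 2 / a ≤ β) (hβb : (k : ℝ) ^ 2 / b ≤ β) (hη : 1 ≤ η) (hβη : β * η ≤ 1 / 2)
    {ρ ρ₁ ρ₂ κ v : ℝ} (hρ : 0 < ρ) (hρ₁ : 0 < ρ₁) (hρ₂ : 0 < ρ₂) (hκ : 0 ≤ κ) (hv : 0 < v)
    (hκ₁ : ρ * (a + b).choose k * (1 + 2 * β * η) * ((a : ℝ) / (a + b)) - ρ₁ * a.choose k ≤ κ)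
    (hκ₂ : ρ * (a + b).choose k * (1 + 2 * β * η) * ((b : ℝ) / (a + b)) - ρ₂ * b.choose k ≤ κ)
    (hv₁ : v ≤ a.choose k * (1 - Real.exp (-ρ))) (hv₁' : v ≤ a.choose k * (1 - Real.exp (-ρ₁)))
    (hv₂ : v ≤ b.choose k * (1 - Real.exp (-ρ))) (hv₂' : v ≤ b.choose k * (1 - Real.exp (-ρ₂))) :
    clockExp (splitRate k a b ρ₁ ρ₂) logSols ≤ clockExp (fun _ : Clause k (a + b) => ρ) logSols +
      ((a + b : ℕ) + 1) * (2 * κ * Real.sqrt (2 ^ k / v) +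
        ρ * (a + b).choose k * (2 * β / η)) := by
  have hM : (0 : ℝ) < (a + b).choose k := by exact_mod_cast Nat.choose_pos (by omega)
  have hMa : (0 : ℝ) < a.choose k := by exact_mod_cast Nat.choose_pos (by omega)
  have hMb : (0 : ℝ) < b.choose k := by exact_mod_cast Nat.choose_pos (by omega)
  have hβ : 0 ≤ β := le_trans (by positivity) hβa
  set s := splitRate k a b ρ₁ ρ₂ with hs
  have hs0 : ∀ c, 0 ≤ s c := splitRate_nonneg hρ₁.le hρ₂.le
  -- The allowance for a negative slope: the expectation plus `t * D` is shown to be nondecreasing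
  -- along the path.
  set D : ℝ := ((a + b : ℕ) + 1) * (2 * κ * Real.sqrt (2 ^ k / v) +
        ρ * (a + b).choose k * (2 * β / η)) with hD
  have hd := fun t => hasDerivAt_clockExp s (fun c => ρ - s c) logSols t
  have hderiv : ∀ t ∈ Set.Ioo (0 : ℝ) 1, 0 ≤ (∑ c, (ρ - s c) *
      clockExp (fun c => s c + t * (ρ - s c))
        (fun ω => logSols (Function.update ω c true) - logSols ω)) + D := by
    intro t ht
    set r : Clause k (a + b) → ℝ := fun c => s c + t * (ρ - s c) with hr
    have hr0 : ∀ c, 0 ≤ r c := fun c => by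
      have : r c = (1 - t) * s c + t * ρ := by simp only [hr]; ring
      rw [this]
      have := hs0 c
      have := ht.1
      have := ht.2
      have : 0 ≤ 1 - t := by linarith
      positivity
    set T : Clause k (a + b) → ℝ := fun c => clockExp r (fun ω => logLoss Violates (sols ω) c)
      with hT
    have hT0 : ∀ c, 0 ≤ T c := fun c => clockExp_nonneg hr0 fun ω => logLoss_nonneg _ _ _
    have hneg : ∀ c, clockExp r (fun ω => logSols (Function.update ω c true) - logSols ω) =
        - T c := by
      intro c
      rw [hT, clockExp_sub]
      simp only [← logSols_sub_update]
      rw [clockExp_sub]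
      ring
    have hleft : ∑ c ∈ leftClauses k a b, s c * T c = ρ₁ * ∑ c ∈ leftClauses k a b, T c := by
      rw [Finset.mul_sum]
      exact Finset.sum_congr rfl fun c hc => by rw [hs, splitRate_of_mem_left hk hc]
    have hright : ∑ c ∈ rightClauses k a b, s c * T c = ρ₂ * ∑ c ∈ rightClauses k a b, T c := by
      rw [Finset.mul_sum]
      exact Finset.sum_congr rfl fun c hc => by rw [hs, splitRate_of_mem_right hk hc]
    have hall : ∑ c, s c * T c =
        ρ₁ * ∑ c ∈ leftClauses k a b, T c + ρ₂ * ∑ c ∈ rightClauses k a b, T c := by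
      simp only [hs, splitRate, add_mul, ite_mul, zero_mul, Finset.sum_add_distrib,
        Finset.sum_ite_mem, Finset.univ_inter, Finset.mul_sum]
    have hsum : (∑ c, (ρ - s c) * clockExp r
        (fun ω => logSols (Function.update ω c true) - logSols ω)) =
        ρ₁ * ∑ c ∈ leftClauses k a b, T c + ρ₂ * ∑ c ∈ rightClauses k a b, T c - ρ * ∑ c, T c := by
      rw [← hall, Finset.mul_sum, ← Finset.sum_sub_distrib]
      exact Finset.sum_congr rfl fun c _ => by rw [hneg c]; ring
    have hmean : (1 / ((a + b).choose k : ℝ)) * ∑ c, T c ≤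
        ((1 + 2 * β * η) * ((a : ℝ) / (a + b)) / a.choose k) * ∑ c ∈ leftClauses k a b, T c +
        ((1 + 2 * β * η) * ((b : ℝ) / (a + b)) / b.choose k) * ∑ c ∈ rightClauses k a b, T c +
        2 * β / η * ((a + b : ℕ) + 1) := by
      have h := clockExp_mono hr0 fun ω =>
        sum_logLoss_univ_le hk ha hb hβa hβb hη hβη (sols ω)
      rw [clockExp_add, clockExp_add, clockExp_mul_left, clockExp_mul_left, clockExp_mul_left,
        clockExp_mul_left, clockExp_sum, clockExp_sum, clockExp_sum] at h
      refine h.trans (add_le_add_right ?_ _)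
      refine mul_le_mul_of_nonneg_left ?_ (by positivity)
      have h2 := clockExp_mono hr0 fun ω => logSols_le (k := k) (n := a + b) ω
      rw [clockExp_const] at h2
      exact h2
    -- The rate along the path lies between its endpoints, so the smaller endpoint already supplies
    -- the bound by `v`.
    have hrate : ∀ τ : ℝ, 0 < τ → ∀ m : ℝ, 0 ≤ m → v ≤ m * (1 - Real.exp (-ρ)) →
        v ≤ m * (1 - Real.exp (-τ)) → 0 < τ + t * (ρ - τ) ∧
        v ≤ m * (1 - Real.exp (-(τ + t * (ρ - τ)))) := by
      intro τ hτ m hm h1 h2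
      have h3 : min ρ τ ≤ τ + t * (ρ - τ) := by
        rcases le_total ρ τ with h | h
        · rw [min_eq_left h]; nlinarith [ht.1, ht.2]
        · rw [min_eq_right h]; nlinarith [ht.1, ht.2]
      refine ⟨(lt_min hρ hτ).trans_le h3, ?_⟩
      have h4 : v ≤ m * (1 - Real.exp (-(min ρ τ))) := by
        rcases le_total ρ τ with h | h
        · rwa [min_eq_left h]
        · rwa [min_eq_right h]
      refine h4.trans (mul_le_mul_of_nonneg_left ?_ hm)
      have := Real.exp_le_exp.2 (neg_le_neg h3)
      linarith
    obtain ⟨hτ₁, hτv₁⟩ := hrate ρ₁ hρ₁ _ hMa.le hv₁ hv₁'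
    obtain ⟨hτ₂, hτv₂⟩ := hrate ρ₂ hρ₂ _ hMb.le hv₂ hv₂'
    have hT₁ := sum_clockExp_logLoss_le (Fin.castAddEmb b) hr0 hτ₁ hv hτv₁ (fun c hc => by
      simp only [hr, hs]; rw [splitRate_of_mem_left hk hc])
    have hT₂ := sum_clockExp_logLoss_le (Fin.natAddEmb a) hr0 hτ₂ hv hτv₂ (fun c hc => by
      simp only [hr, hs]; rw [splitRate_of_mem_right hk hc])
    change ∑ c ∈ leftClauses k a b, T c ≤ _ at hT₁
    change ∑ c ∈ rightClauses k a b, T c ≤ _ at hT₂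
    have hT₁0 : 0 ≤ ∑ c ∈ leftClauses k a b, T c := Finset.sum_nonneg fun c _ => hT0 c
    have hT₂0 : 0 ≤ ∑ c ∈ rightClauses k a b, T c := Finset.sum_nonneg fun c _ => hT0 c
    rw [hsum]
    set X₁ := ∑ c ∈ leftClauses k a b, T c
    set X₂ := ∑ c ∈ rightClauses k a b, T c
    set X := ∑ c, T c
    set q : ℝ := ((a + b : ℕ) + 1) * Real.sqrt (2 ^ k / v) with hq
    have hmean' := mul_le_mul_of_nonneg_left hmean (mul_pos hρ hM).le
    have e1 : ρ * (a + b).choose k * (1 / ((a + b).choose k : ℝ) * X) = ρ * X := by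
      field_simp
    -- The block rate pays for the convexity bound up to an excess of at most `κ`, which is charged
    -- at the mean loss per `k`-set.
    have b1 : (ρ * (a + b).choose k * (1 + 2 * β * η) * ((a : ℝ) / (a + b)) - ρ₁ * a.choose k) *
        (X₁ / a.choose k) ≤ κ * q := by
      refine (mul_le_mul_of_nonneg_right hκ₁ (by positivity)).trans ?_
      refine mul_le_mul_of_nonneg_left ?_ hκ
      rw [div_le_iff₀ hMa, mul_comm]; exact hT₁
    have b2 : (ρ * (a + b).choose k * (1 + 2 * β * η) * ((b : ℝ) / (a + b)) - ρ₂ * b.choose k) *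
        (X₂ / b.choose k) ≤ κ * q := by
      refine (mul_le_mul_of_nonneg_right hκ₂ (by positivity)).trans ?_
      refine mul_le_mul_of_nonneg_left ?_ hκ
      rw [div_le_iff₀ hMb, mul_comm]; exact hT₂
    have e2 : ρ₁ * a.choose k * (X₁ / a.choose k) = ρ₁ * X₁ := by field_simp
    have e3 : ρ₂ * b.choose k * (X₂ / b.choose k) = ρ₂ * X₂ := by field_simp
    rw [e1] at hmean'
    rw [sub_mul, e2] at b1
    rw [sub_mul, e3] at b2
    have e4 : ρ * (a + b).choose k * ((1 + 2 * β * η) * ((a : ℝ) / (a + b)) / a.choose k * X₁ +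
        (1 + 2 * β * η) * ((b : ℝ) / (a + b)) / b.choose k * X₂ +
        2 * β / η * ((a + b : ℕ) + 1)) =
        ρ * (a + b).choose k * (1 + 2 * β * η) * ((a : ℝ) / (a + b)) * (X₁ / a.choose k) +
        ρ * (a + b).choose k * (1 + 2 * β * η) * ((b : ℝ) / (a + b)) * (X₂ / b.choose k) +
        ((a + b : ℕ) + 1) * (ρ * (a + b).choose k * (2 * β / η)) := by ring
    rw [e4] at hmean'
    have e5 : D = 2 * (κ * q) + ((a + b : ℕ) + 1) * (ρ * (a + b).choose k * (2 * β / η)) := by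
      rw [hD, hq]; ring
    rw [e5]
    linarith
  have hd' : ∀ t, HasDerivAt (fun t => clockExp (fun c => s c + t * (ρ - s c)) logSols + t * D)
      ((∑ c, (ρ - s c) * clockExp (fun c => s c + t * (ρ - s c))
        (fun ω => logSols (Function.update ω c true) - logSols ω)) + D) t := by
    intro t
    have := (hd t).fun_add ((hasDerivAt_id' t).mul_const D)
    rwa [one_mul] at this
  have hmono : MonotoneOn (fun t => clockExp (fun c => s c + t * (ρ - s c)) logSols + t * D)
      (Set.Icc 0 1) := by
    refine monotoneOn_of_deriv_nonneg (convex_Icc 0 1)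
      (fun t _ => (hd' t).continuousAt.continuousWithinAt)
      (fun t _ => (hd' t).differentiableAt.differentiableWithinAt) ?_
    intro t ht
    rw [interior_Icc] at ht
    rw [(hd' t).deriv]
    exact hderiv t ht
  simpa using hmono (Set.left_mem_Icc.2 zero_le_one) (Set.right_mem_Icc.2 zero_le_one) zero_le_one

/-- The indicator of unsatisfiability. -/
noncomputable def unsatInd {k n : ℕ} (ω : Clause k n → Bool) : ℝ :=
  if (sols ω).card = 0 then 1 else 0

lemma unsatInd_nonneg {k n : ℕ} (ω : Clause k n → Bool) : 0 ≤ unsatInd ω := by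
  unfold unsatInd; split_ifs <;> simp

lemma unsatInd_le_update {k n : ℕ} (ω : Clause k n → Bool) (c : Clause k n) :
    unsatInd ω ≤ unsatInd (Function.update ω c true) := by
  classical
  unfold unsatInd
  rw [sols_update]
  have := Finset.card_filter_le (sols ω) fun x => ¬ Violates x c
  split_ifs with h1 h2
  · exact le_rfl
  · omega
  · exact zero_le_one
  · exact le_rfl

/-- For z₁, z₂ ≥ 1 one has (1+z₁)(1+z₂) ≤ 4z₁z₂, and log 4 ≤ 2. If a block is unsatisfiable, the
trivial bounds a+1 and b+1 are used instead. -/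
lemma logSols_add_logSols_le {ω : Clause k (a + b) → Bool}
    (hω : ∀ c, ω c = true → c ∈ Set.range (clauseMap (k := k) (Fin.castAddEmb (n := a) b)) ∨
      c ∈ Set.range (clauseMap (k := k) (Fin.natAddEmb (m := b) a))) :
    logSols (ω ∘ clauseMap (Fin.castAddEmb b)) + logSols (ω ∘ clauseMap (Fin.natAddEmb a)) ≤
      logSols ω + 2 + ((a + b : ℕ) + 2) * (unsatInd (ω ∘ clauseMap (Fin.castAddEmb b)) +
        unsatInd (ω ∘ clauseMap (Fin.natAddEmb a))) := by
  have hmul := card_sols_mul_le hω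
  set ω₁ := ω ∘ clauseMap (k := k) (Fin.castAddEmb (n := a) b)
  set ω₂ := ω ∘ clauseMap (k := k) (Fin.natAddEmb (m := b) a)
  have h0 := logSols_nonneg ω
  have h₁ := logSols_le ω₁
  have h₂ := logSols_le ω₂
  have hab : (0 : ℝ) ≤ (a + b : ℕ) + 2 := by positivity
  have u₁ := unsatInd_nonneg ω₁
  have u₂ := unsatInd_nonneg ω₂
  by_cases c₁ : (sols ω₁).card = 0
  · have : unsatInd ω₁ = 1 := by simp [unsatInd, c₁]
    rw [this]
    push_cast at *
    nlinarith
  by_cases c₂ : (sols ω₂).card = 0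
  · have : unsatInd ω₂ = 1 := by simp [unsatInd, c₂]
    rw [this]
    push_cast at *
    nlinarith
  have p₁ : (1 : ℝ) ≤ (sols ω₁).card := by exact_mod_cast Nat.one_le_iff_ne_zero.2 c₁
  have p₂ : (1 : ℝ) ≤ (sols ω₂).card := by exact_mod_cast Nat.one_le_iff_ne_zero.2 c₂
  have hmul' : ((sols ω₁).card : ℝ) * (sols ω₂).card ≤ (sols ω).card := by exact_mod_cast hmul
  have h3 : logSols ω₁ + logSols ω₂ ≤ logSols ω + 2 := by
    unfold logSols
    have q₁ : 1 + ((sols ω₁).card : ℝ) ≠ 0 := by positivity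
    have q₂ : 1 + ((sols ω₂).card : ℝ) ≠ 0 := by positivity
    have q : 1 + ((sols ω).card : ℝ) ≠ 0 := by positivity
    have h4 : (1 + ((sols ω₁).card : ℝ)) * (1 + (sols ω₂).card) ≤
        (1 + (sols ω).card) * 4 := by nlinarith
    have h5 := Real.log_le_log (by positivity) h4
    rw [Real.log_mul q₁ q₂, Real.log_mul q (by norm_num)] at h5
    have h6 : Real.log 4 ≤ 2 := by
      have : (4 : ℝ) = 2 ^ 2 := by norm_num
      rw [this, Real.log_pow]
      push_cast
      linarith [Real.log_two_lt_d9]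
    linarith
  have : 0 ≤ ((a + b : ℕ) + 2 : ℝ) * (unsatInd ω₁ + unsatInd ω₂) := by positivity
  linarith

/-- Clauses meeting both blocks have rate zero, so markings containing one have weight zero and the
pointwise bound is needed only for the others. The block expectations are marginals. -/
lemma clockExp_add_clockExp_le_splitRate (hk : 1 ≤ k) {ρ₁ ρ₂ : ℝ} (hρ₁ : 0 ≤ ρ₁) (hρ₂ : 0 ≤ ρ₂) :
    clockExp (fun _ : Clause k a => ρ₁) logSols + clockExp (fun _ : Clause k b => ρ₂) logSols ≤
      clockExp (splitRate k a b ρ₁ ρ₂) logSols + 2 +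
      ((a + b : ℕ) + 2) * (clockExp (fun _ : Clause k a => ρ₁) unsatInd +
        clockExp (fun _ : Clause k b => ρ₂) unsatInd) := by
  have hl : splitRate k a b ρ₁ ρ₂ ∘ clauseMap (Fin.castAddEmb b) = fun _ => ρ₁ := by
    funext c
    exact splitRate_of_mem_left hk (Finset.mem_map_of_mem _ (Finset.mem_univ c))
  have hr : splitRate k a b ρ₁ ρ₂ ∘ clauseMap (Fin.natAddEmb a) = fun _ => ρ₂ := by
    funext c
    exact splitRate_of_mem_right hk (Finset.mem_map_of_mem _ (Finset.mem_univ c))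
  simp only [← hl, ← hr, ← clockExp_comp_embedding]
  have key := clockExp_mono_of_weight (splitRate_nonneg hρ₁ hρ₂)
    (g := fun ω => logSols (ω ∘ clauseMap (k := k) (Fin.castAddEmb (n := a) b)) +
      logSols (ω ∘ clauseMap (k := k) (Fin.natAddEmb (m := b) a)))
    (h := fun ω => logSols ω + 2 + ((a + b : ℕ) + 2) *
      (unsatInd (ω ∘ clauseMap (k := k) (Fin.castAddEmb (n := a) b)) +
        unsatInd (ω ∘ clauseMap (k := k) (Fin.natAddEmb (m := b) a)))) fun ω hω => ?_
  · rwa [clockExp_add, clockExp_add, clockExp_add, clockExp_mul_left, clockExp_add,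
      clockExp_const] at key
  refine logSols_add_logSols_le fun c hc => ?_
  by_contra hcon
  rw [not_or] at hcon
  refine hω (Finset.prod_eq_zero (Finset.mem_univ c) ?_)
  have h1 : c ∉ leftClauses k a b := fun h => by
    obtain ⟨d, -, hd⟩ := Finset.mem_map.1 h
    exact hcon.1 ⟨d, hd⟩
  have h2 : c ∉ rightClauses k a b := fun h => by
    obtain ⟨d, -, hd⟩ := Finset.mem_map.1 h
    exact hcon.2 ⟨d, hd⟩
  simp [clockWeight, splitRate, h1, h2, hc]

end interpolation

/-! ### Fekete's lemma for balanced splittings, with a logarithmic error -/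

section superadditive

/-- Halving the multiplier repeatedly keeps every splitting balanced. A remainder in [m, 2m) never
becomes a piece that is too small. -/
lemma mul_add_le_of_balanced_superadditive {s : ℕ → ℝ} {n₀ : ℕ}
    (hs : ∀ a b, n₀ ≤ a → n₀ ≤ b → a + b ≤ 4 * a → a + b ≤ 4 * b → s a + s b ≤ s (a + b))
    {m : ℕ} (hm : n₀ ≤ m) (q : ℕ) : ∀ ρ, m ≤ ρ → ρ < 2 * m → q * s m + s ρ ≤ s (q * m + ρ) := by
  have hmul : ∀ q : ℕ, 1 ≤ q → q * s m ≤ s (q * m) := by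
    intro q
    induction q using Nat.strong_induction_on with
    | _ q ih =>
      intro hq
      rcases Nat.lt_or_ge q 2 with h | h
      · have : q = 1 := by omega
        subst this
        simp
      · obtain ⟨c, d, hcd, hc, hd, hc4, hd4⟩ :
            ∃ c d, q = c + d ∧ 1 ≤ c ∧ 1 ≤ d ∧ q ≤ 4 * c ∧ q ≤ 4 * d :=
          ⟨q / 2, q - q / 2, by omega, by omega, by omega, by omega, by omega⟩
        have h1 := ih c (by omega) hc
        have h2 := ih d (by omega) hd
        have h3 := hs (c * m) (d * m) (by nlinarith) (by nlinarith) (by nlinarith) (by nlinarith)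
        subst hcd
        rw [add_mul]
        push_cast
        linarith
  induction q using Nat.strong_induction_on with
  | _ q ih =>
    intro ρ h1 h2
    rcases Nat.eq_zero_or_pos q with h | h
    · subst h; simp
    · obtain ⟨c, d, hcd, hc, hc4, hd4⟩ :
          ∃ c d, q = c + d ∧ 1 ≤ c ∧ q + 2 ≤ 4 * c ∧ q ≤ 4 * d + 3 :=
        -- The pure multiple gets the larger share because the other piece also contains `ρ`; the
        -- two inequalities use ρ < 2m and m ≤ ρ respectively.
        ⟨q / 2 + 1, q - (q / 2 + 1), by omega, by omega, by omega, by omega⟩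
      have e1 := ih d (by omega) ρ h1 h2
      have e2 := hmul c hc
      have e3 := hs (c * m) (d * m + ρ) (by nlinarith) (by nlinarith) (by
        subst hcd; nlinarith) (by subst hcd; nlinarith)
      subst hcd
      have : (c + d) * m + ρ = c * m + (d * m + ρ) := by ring
      rw [this]
      push_cast
      linarith

/-- A form of Fekete's lemma in which superadditivity is only required for balanced splittings. -/
lemma exists_tendsto_of_balanced_superadditive {s : ℕ → ℝ} {n₀ : ℕ} (hn₀ : 1 ≤ n₀) {B : ℝ}
    (hB : ∀ n, n₀ ≤ n → |s n| ≤ B * n)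
    (hs : ∀ a b, n₀ ≤ a → n₀ ≤ b → a + b ≤ 4 * a → a + b ≤ 4 * b → s a + s b ≤ s (a + b)) :
    ∃ L, Tendsto (fun n : ℕ => s n / n) atTop (𝓝 L) := by
  set T : Set ℝ := (fun n : ℕ => s n / n) '' Set.Ici n₀ with hT
  have hpos : ∀ n, n₀ ≤ n → (0 : ℝ) < n := fun n hn => by exact_mod_cast (by omega : 0 < n)
  have hTb : BddAbove T := by
    refine ⟨B, ?_⟩
    rintro _ ⟨n, hn, rfl⟩
    have hn' := hpos n hn
    simp only
    rw [div_le_iff₀ hn']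
    exact (le_abs_self _).trans (hB n hn)
  have hTne : T.Nonempty := ⟨_, n₀, Set.mem_Ici.2 le_rfl, rfl⟩
  refine ⟨sSup T, ?_⟩
  rw [Metric.tendsto_atTop]
  intro ε hε
  obtain ⟨_, ⟨m, hm, rfl⟩, hlt⟩ := exists_lt_of_lt_csSup hTne
    (show sSup T - ε / 2 < sSup T by linarith)
  have hm' := hpos m hm
  obtain ⟨N, hN⟩ := exists_nat_gt (8 * B * m / ε)
  refine ⟨max (max N (2 * m)) n₀, fun n hn => ?_⟩
  have hnN : N ≤ n := (le_max_left _ _).trans ((le_max_left _ _).trans hn)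
  have hnm : 2 * m ≤ n := (le_max_right _ _).trans ((le_max_left _ _).trans hn)
  have hn0 : n₀ ≤ n := (le_max_right _ _).trans hn
  have hn' := hpos n hn0
  have hle : s n / n ≤ sSup T := le_csSup hTb ⟨n, hn0, rfl⟩
  have hmN : 0 < m := by have : n₀ ≤ m := hm; omega
  obtain ⟨q, ρ, hq, hρ1, hρ2⟩ : ∃ q ρ, n = q * m + ρ ∧ m ≤ ρ ∧ ρ < 2 * m := by
    -- The quotient is lowered by one to put the remainder in [m, 2m).
    refine ⟨n / m - 1, n % m + m, ?_, by omega, ?_⟩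
    · have h1 := Nat.div_add_mod n m
      have h2 : 1 ≤ n / m := (Nat.one_le_div_iff hmN).2 (by omega)
      obtain ⟨d, hd⟩ := Nat.exists_eq_add_of_le' h2
      rw [hd] at h1 ⊢
      rw [Nat.add_sub_cancel]
      nlinarith
    · have := Nat.mod_lt n hmN
      omega
  have key := mul_add_le_of_balanced_superadditive hs hm q ρ hρ1 hρ2
  rw [← hq] at key
  have hsm : |s m| ≤ B * m := hB m hm
  have hsρ : |s ρ| ≤ B * ρ := hB ρ (le_trans hm hρ1)
  have hB0 : 0 ≤ B := by
    by_contra h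
    have : B * m < 0 := mul_neg_of_neg_of_pos (not_le.1 h) hm'
    linarith [abs_nonneg (s m)]
  have hρ3 : (ρ : ℝ) ≤ 2 * m := by exact_mod_cast hρ2.le
  have hn2 : (n : ℝ) = q * m + ρ := by exact_mod_cast hq
  have h1 : n * (s m / m) - 4 * B * m ≤ s n := by
    have e : n * (s m / m) = q * s m + ρ * (s m / m) := by
      rw [hn2]; field_simp
    have e2 : s m / m ≤ B := by
      rw [div_le_iff₀ hm']; exact (le_abs_self _).trans hsm
    have e3 : ρ * (s m / m) ≤ (2 * m) * B := by
      refine (mul_le_mul_of_nonneg_left e2 (by positivity)).trans ?_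
      exact mul_le_mul_of_nonneg_right hρ3 hB0
    have e4 : -(B * (2 * m)) ≤ s ρ := by
      have : B * ρ ≤ B * (2 * m) := mul_le_mul_of_nonneg_left hρ3 hB0
      have := (abs_le.1 hsρ).1
      linarith
    linarith
  have h2 : 4 * B * m / n < ε / 2 := by
    rw [div_lt_iff₀ hn']
    have : (N : ℝ) ≤ n := by exact_mod_cast hnN
    rw [div_lt_iff₀ hε] at hN
    nlinarith
  have h3 : s m / m - 4 * B * m / n ≤ s n / n := by
    rw [le_div_iff₀ hn', sub_mul, div_mul_cancel₀ _ hn'.ne']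
    linarith
  rw [Real.dist_eq, abs_lt]
  constructor
  · simp only at hlt
    linarith
  · linarith

/-- A form of 1 + εt ≤ (1-t)^(-ε) with t = c/y. With y = log n, the decay of y^(-ε) over one
splitting pays for an error of order 1/y^(1+ε). -/
lemma log_rpow_neg_add_le {x y ε c : ℝ} (hε : 0 < ε) (hx : 0 < x) (hy : x + c ≤ y) (hc : 0 ≤ c) :
    y ^ (-ε) + ε * c * (1 / y ^ (1 + ε)) ≤ x ^ (-ε) := by
  have hy0 : 0 < y := by linarith
  have h1 : 1 + ε * (c / y) ≤ (x / y) ^ (-ε) := by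
    rw [Real.rpow_def_of_pos (by positivity)]
    have h2 := Real.log_le_sub_one_of_pos (show 0 < x / y by positivity)
    have h3 := Real.add_one_le_exp (Real.log (x / y) * -ε)
    have h4 : x / y + c / y ≤ 1 := by
      rw [← add_div, div_le_one hy0]; exact hy
    nlinarith
  rw [Real.div_rpow hx.le hy0.le, le_div_iff₀ (by positivity)] at h1
  refine le_trans (le_of_eq ?_) h1
  have : y ^ (-ε) / y = 1 / y ^ (1 + ε) := by
    rw [Real.rpow_add hy0, Real.rpow_one, Real.rpow_neg hy0.le]
    field_simp
  rw [← this]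
  field_simp

/-- The de Bruijn–Erdős variant of Fekete's lemma, with an error term `n / (log n) ^ (1 + ε)`. -/
lemma exists_tendsto_of_superadditive_log_error {x : ℕ → ℝ} {n₀ : ℕ} {B C ε : ℝ} (hε : 0 < ε)
    (hC : 0 ≤ C) (hB : ∀ n, n₀ ≤ n → |x n| ≤ B * n)
    (hx : ∀ a b, n₀ ≤ a → n₀ ≤ b → a + b ≤ 4 * a → a + b ≤ 4 * b →
      x a + x b ≤ x (a + b) + (a + b : ℕ) * (C / Real.log (a + b : ℕ) ^ (1 + ε))) :
    ∃ L, Tendsto (fun n : ℕ => x n / n) atTop (𝓝 L) := by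
  -- In a balanced splitting each part is at most 3/4 of the whole, so its logarithm is smaller by
  -- at least `l`. The choice of `K` gives K * (ε * l) = C.
  set l : ℝ := Real.log (4 / 3) with hl
  have hl0 : 0 < l := Real.log_pos (by norm_num)
  set K : ℝ := C / (ε * l) with hK
  have hK0 : 0 ≤ K := by positivity
  set m₀ := max n₀ 3 with hm₀
  have hlog : ∀ n : ℕ, m₀ ≤ n → 1 ≤ Real.log n := by
    intro n hn
    have h3 : (3 : ℝ) ≤ n := by exact_mod_cast (le_max_right _ _).trans hn
    rw [Real.le_log_iff_exp_le (by linarith)]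
    linarith [Real.exp_one_lt_d9]
  have hW : ∀ a n : ℕ, m₀ ≤ a → 4 * a ≤ 3 * n →
      K * Real.log n ^ (-ε) + C / Real.log n ^ (1 + ε) ≤ K * Real.log a ^ (-ε) := by
    intro a n ha han
    have ha3 : 3 ≤ a := (le_max_right _ _).trans ha
    have ha0 : (0 : ℝ) < a := by exact_mod_cast (by omega : 0 < a)
    have hn0 : (0 : ℝ) < n := by exact_mod_cast (by omega : 0 < n)
    have h1 : Real.log a + l ≤ Real.log n := by
      rw [hl, ← Real.log_mul ha0.ne' (by norm_num)]
      refine Real.log_le_log (by positivity) ?_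
      have : (4 : ℝ) * a ≤ 3 * n := by exact_mod_cast han
      linarith
    have h2 := log_rpow_neg_add_le hε (by linarith [hlog a ha]) h1 hl0.le
    have h3 := mul_le_mul_of_nonneg_left h2 hK0
    refine le_trans (le_of_eq ?_) h3
    have : K * (ε * l) = C := by rw [hK]; field_simp
    rw [mul_add, ← mul_assoc, this]
    ring
  have hlim0 : Tendsto (fun n : ℕ => K * Real.log n ^ (-ε)) atTop (𝓝 0) := by
    have := ((tendsto_rpow_neg_atTop hε).comp
      (Real.tendsto_log_atTop.comp tendsto_natCast_atTop_atTop)).const_mul K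
    rw [mul_zero] at this
    exact this
  -- Subtracting `n * (K * Real.log n ^ (-ε))` absorbs the error exactly, and after division by n
  -- the correction tends to 0.
  obtain ⟨L, hL⟩ := exists_tendsto_of_balanced_superadditive
    (s := fun n => x n - n * (K * Real.log n ^ (-ε))) (n₀ := m₀) (B := B + K)
    ((by norm_num : 1 ≤ 3).trans (le_max_right _ _)) (by
      intro n hn
      have h1 := hB n ((le_max_left _ _).trans hn)
      have h2 : Real.log n ^ (-ε) ≤ 1 :=
        Real.rpow_le_one_of_one_le_of_nonpos (hlog n hn) (by linarith)
      have h3 : 0 ≤ Real.log n ^ (-ε) := Real.rpow_nonneg (by linarith [hlog n hn]) _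
      have hn0 : (0 : ℝ) ≤ n := by positivity
      calc |x n - n * (K * Real.log n ^ (-ε))|
          ≤ |x n| + |n * (K * Real.log n ^ (-ε))| := abs_sub _ _
        _ ≤ B * n + n * (K * 1) := by
            rw [abs_of_nonneg (a := n * (K * Real.log n ^ (-ε))) (by positivity)]
            gcongr
        _ = (B + K) * n := by ring)
    (by
      intro a b ha hb hab1 hab2
      have e := hx a b ((le_max_left _ _).trans ha) ((le_max_left _ _).trans hb) hab1 hab2
      have wa := hW a (a + b) ha (by omega)
      have wb := hW b (a + b) hb (by omega)
      have wa' := mul_le_mul_of_nonneg_left wa (Nat.cast_nonneg (α := ℝ) a)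
      have wb' := mul_le_mul_of_nonneg_left wb (Nat.cast_nonneg (α := ℝ) b)
      have hab : ((a + b : ℕ) : ℝ) = a + b := by push_cast; ring
      generalize Real.log ((a + b : ℕ) : ℝ) = y at *
      rw [hab] at *
      nlinarith)
  refine ⟨L, ?_⟩
  have := hL.add hlim0
  rw [add_zero] at this
  refine this.congr' ?_
  filter_upwards [eventually_ge_atTop 1] with n hn
  have hn0 : (n : ℝ) ≠ 0 := by
    have : 0 < n := hn
    positivity
  field_simp
  ring

end superadditive

/-! ### The law of the random formula in terms of clock rates -/

section law

/-- The rate at which a clause is selected with probability `p`. -/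
noncomputable def rate (p : ℝ) : ℝ := -Real.log (1 - p)

lemma exp_neg_rate {p : ℝ} (hp : p < 1) : Real.exp (-rate p) = 1 - p := by
  rw [rate, neg_neg, Real.exp_log (by linarith)]

lemma rate_nonneg {p : ℝ} (h0 : 0 ≤ p) (hp : p < 1) : 0 ≤ rate p := by
  rw [rate, neg_nonneg]
  exact Real.log_nonpos (by linarith) (by linarith)

variable {k n : ℕ}

/-- Formulas correspond to markings of the clauses. -/
noncomputable def formulaEquiv (k n : ℕ) : (Clause k n → Bool) ≃ Formula k n where
  toFun := toFormula
  invFun F c := by classical exact decide (c ∈ F)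
  left_inv ω := by funext c; cases h : ω c <;> simp [toFormula, h]
  right_inv F := by ext c; simp [toFormula]

/-- The condition p < 1 is essential: at p = 1 the rate would have to be infinite. -/
lemma formulaLaw_real_singleton {α : ℝ} (hp : (clauseProb k n α : ℝ) < 1) (ω : Clause k n → Bool) :
    (formulaLaw k n α).real {toFormula ω} =
      ∏ c, clockWeight (rate (clauseProb k n α)) (ω c) := by
  classical
  rw [formulaLaw, setBernoulli_real_singleton _ (Set.subset_univ _) (Set.toFinite _)]
  have h1 : ∀ c, clockWeight (rate (clauseProb k n α)) (ω c) =
      if ω c = true then (clauseProb k n α : ℝ) else 1 - clauseProb k n α := by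
    intro c
    unfold clockWeight
    rw [exp_neg_rate hp]
    simp
  simp only [h1]
  rw [Finset.prod_ite, Finset.prod_const, Finset.prod_const]
  congr 2
  · rw [← Set.ncard_coe_finset]
    congr 1
    ext c; simp [toFormula]
  · rw [← Set.ncard_coe_finset]
    congr 1
    ext c; simp [toFormula]

lemma integral_formulaLaw {α : ℝ} (hp : (clauseProb k n α : ℝ) < 1) (h : Formula k n → ℝ) :
    ∫ F, h F ∂(formulaLaw k n α) =
      clockExp (fun _ : Clause k n => rate (clauseProb k n α)) (fun ω => h (toFormula ω)) := by
  classical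
  have : IsProbabilityMeasure (formulaLaw k n α) := by unfold formulaLaw; infer_instance
  have : Fintype (Formula k n) := Fintype.ofFinite _
  rw [integral_fintype (Integrable.of_finite)]
  rw [← Equiv.sum_comp (formulaEquiv k n)]
  refine Finset.sum_congr rfl fun ω _ => ?_
  rw [smul_eq_mul]
  congr 1
  exact formulaLaw_real_singleton hp ω

lemma formulaLaw_real_Z_eq_zero {α : ℝ} (hp : (clauseProb k n α : ℝ) < 1) :
    (formulaLaw k n α).real {F | Z F = 0} =
      clockExp (fun _ : Clause k n => rate (clauseProb k n α)) unsatInd := by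
  have := integral_formulaLaw hp (Set.indicator {F : Formula k n | Z F = 0} 1)
  rw [integral_indicator_one (Set.toFinite _).measurableSet] at this
  rw [this]
  congr 1
  funext ω
  simp [Set.indicator, unsatInd, Z_toFormula]

lemma P_zero_eq (k n : ℕ) (α : ℝ) : P k n α 0 = (formulaLaw k n α).real {F | Z F = 0} := by
  unfold P
  congr 1
  ext F
  simp

end law

/-! ### Asymptotics of the rates and near superadditivity -/

section asymptotics

variable {k : ℕ}

lemma clauseProb_eq {n : ℕ} {α : ℝ} (h0 : 0 ≤ α) (h1 : α * n / ((n.choose k : ℝ) * 2 ^ k) ≤ 1) :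
    (clauseProb k n α : ℝ) = α * n / ((n.choose k : ℝ) * 2 ^ k) := by
  unfold clauseProb
  rw [Set.projIcc_of_mem zero_le_one ⟨by positivity, h1⟩]

lemma clauseProb_mono (n : ℕ) {α α' : ℝ} (h : α ≤ α') : clauseProb k n α ≤ clauseProb k n α' := by
  unfold clauseProb
  refine Set.monotone_projIcc _ ?_
  gcongr

lemma rate_mono {p q : ℝ} (hpq : p ≤ q) (hq : q < 1) : rate p ≤ rate q := by
  unfold rate
  exact neg_le_neg (Real.log_le_log (by linarith) (by linarith))

lemma le_rate {p : ℝ} (hp : p < 1) : p ≤ rate p := by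
  unfold rate
  linarith [Real.log_le_sub_one_of_pos (show 0 < 1 - p by linarith)]

lemma rate_le {p : ℝ} (hp : p ≤ 1 / 2) : rate p ≤ p + 2 * p ^ 2 := by
  have h1 : 0 < 1 - p := by linarith
  have h := Real.log_le_sub_one_of_pos (inv_pos.2 h1)
  rw [Real.log_inv] at h
  refine h.trans ?_
  have : (1 - p)⁻¹ * (1 - p) = 1 := inv_mul_cancel₀ h1.ne'
  have h2 : (1 - p)⁻¹ ≤ 1 + p + 2 * p ^ 2 := by
    rw [inv_le_iff_one_le_mul₀ h1]
    nlinarith [sq_nonneg p, mul_nonneg (sq_nonneg p) (by linarith : 0 ≤ 1 - 2 * p)]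
  linarith

/-- Quadratic growth makes the clause probability O(1/n), so that the second-order part of the total
rate stays bounded. -/
lemma exists_mul_sq_le_choose (hk : 2 ≤ k) :
    ∃ c : ℝ, 0 < c ∧ ∀ n : ℕ, 2 * k ≤ n → c * (n : ℝ) ^ 2 ≤ n.choose k := by
  refine ⟨1 / (4 * k.factorial), by positivity, fun n hn => ?_⟩
  have h1 : ((n + 1 - k : ℕ) : ℝ) ^ k ≤ k.factorial * n.choose k := by
    have := Nat.pow_sub_le_descFactorial n k
    rw [Nat.descFactorial_eq_factorial_mul_choose] at this
    exact_mod_cast this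
  have h2 : (n : ℝ) / 2 ≤ (n + 1 - k : ℕ) := by
    rw [div_le_iff₀ (by norm_num)]
    exact_mod_cast (by omega : n ≤ (n + 1 - k) * 2)
  have h3 : (1 : ℝ) ≤ (n + 1 - k : ℕ) := by exact_mod_cast (by omega : 1 ≤ n + 1 - k)
  have h4 : ((n : ℝ) / 2) ^ 2 ≤ ((n + 1 - k : ℕ) : ℝ) ^ k :=
    (pow_le_pow_left₀ (by positivity) h2 2).trans (pow_le_pow_right₀ h3 hk)
  have h5 : (0 : ℝ) < k.factorial := by positivity
  rw [div_mul_eq_mul_div, div_le_iff₀ (by positivity)]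
  nlinarith

/-- The total selection rate is linear in the number of variables, up to a bounded error. -/
lemma exists_rate_estimate {α : ℝ} (hα : 0 < α) (h : 2 ≤ k ∨ (k = 1 ∧ α < 2)) :
    ∃ (n₀ : ℕ) (A C : ℝ), 0 ≤ A ∧ 0 ≤ C ∧ ∀ n, n₀ ≤ n → 2 * k ≤ n ∧
      0 < (clauseProb k n α : ℝ) ∧ (clauseProb k n α : ℝ) < 1 ∧
      n.choose k * (clauseProb k n α : ℝ) = α * n / 2 ^ k ∧
      |rate (clauseProb k n α) * n.choose k - A * n| ≤ C := by
  rcases h with hk | ⟨rfl, hα2⟩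
  · obtain ⟨c, hc, hchoose⟩ := exists_mul_sq_le_choose hk
    obtain ⟨N, hN⟩ := exists_nat_ge (2 * α / c)
    refine ⟨max (2 * k) N, α / 2 ^ k, 2 * α ^ 2 / c, by positivity, by positivity, fun n hn => ?_⟩
    have hnk : 2 * k ≤ n := (le_max_left _ _).trans hn
    have hnN : (N : ℝ) ≤ n := by exact_mod_cast (le_max_right _ _).trans hn
    have hn0 : (0 : ℝ) < n := by exact_mod_cast (by omega : 0 < n)
    have hM := hchoose n hnk
    have hM0 : (0 : ℝ) < n.choose k := lt_of_lt_of_le (by positivity) hM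
    have h2k : (1 : ℝ) ≤ 2 ^ k := one_le_pow₀ (by norm_num)
    set q := α * n / ((n.choose k : ℝ) * 2 ^ k) with hq
    have hq0 : 0 < q := by positivity
    have hqle : q ≤ α / (c * n) := by
      rw [hq, div_le_div_iff₀ (by positivity) (by positivity)]
      calc α * n * (c * n) = α * (c * (n : ℝ) ^ 2 * 1) := by ring
        _ ≤ α * (n.choose k * 2 ^ k) := by gcongr
    have hq2 : q ≤ 1 / 2 := by
      refine hqle.trans ?_
      rw [div_le_div_iff₀ (by positivity) (by norm_num)]
      have : 2 * α / c ≤ n := hN.trans hnN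
      rw [div_le_iff₀ hc] at this
      linarith
    have hp := clauseProb_eq (k := k) (n := n) hα.le (by linarith : q ≤ 1)
    rw [← hq] at hp
    rw [hp]
    have hqM : n.choose k * q = α * n / 2 ^ k := by
      rw [hq]; field_simp
    refine ⟨hnk, hq0, by linarith, hqM, ?_⟩
    have r1 := le_rate (show q < 1 by linarith)
    have r2 := rate_le hq2
    have e1 : α / 2 ^ k * n = n.choose k * q := by rw [hqM]; ring
    rw [e1, abs_of_nonneg (by nlinarith)]
    have e2 : rate q * n.choose k - n.choose k * q ≤ 2 * q * (n.choose k * q) := by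
      nlinarith
    refine e2.trans ?_
    rw [hqM]
    calc 2 * q * (α * n / 2 ^ k) ≤ 2 * (α / (c * n)) * (α * n / 1) := by gcongr
      _ = 2 * α ^ 2 / c := by field_simp
  -- For k = 1 the clause probability is the constant α/2, and the total rate is exactly linear in
  -- n. The condition α < 2 keeps the rate finite.
  · refine ⟨2, rate (α / 2), 0, rate_nonneg (by linarith) (by linarith), le_rfl, fun n hn => ?_⟩
    have hn0 : (0 : ℝ) < n := by exact_mod_cast (by omega : 0 < n)
    have hq : α * n / ((n.choose 1 : ℝ) * 2 ^ 1) = α / 2 := by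
      rw [Nat.choose_one_right]; field_simp
    have hp := clauseProb_eq (k := 1) (n := n) hα.le (by rw [hq]; linarith)
    rw [hq] at hp
    rw [hp, Nat.choose_one_right]
    refine ⟨by omega, by linarith, by linarith, by ring, by simp⟩

/-- The expected regularised log-count of solutions. -/
noncomputable def meanLogSols (k : ℕ) (α : ℝ) (n : ℕ) : ℝ :=
  clockExp (fun _ : Clause k n => rate (clauseProb k n α)) logSols

lemma abs_meanLogSols_le {α : ℝ} {n : ℕ} (hp : (clauseProb k n α : ℝ) < 1) (hn : 1 ≤ n) :
    |meanLogSols k α n| ≤ 2 * n := by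
  have hr : ∀ _ : Clause k n, 0 ≤ rate (clauseProb k n α) :=
    fun _ => rate_nonneg (clauseProb k n α).2.1 hp
  unfold meanLogSols
  rw [abs_of_nonneg (clockExp_nonneg hr logSols_nonneg)]
  have := clockExp_mono hr (logSols_le (k := k) (n := n))
  rw [clockExp_const] at this
  have hn' : (1 : ℝ) ≤ n := by exact_mod_cast hn
  linarith

lemma eventually_le_sqrt_sqrt (c : ℝ) : ∀ᶠ n : ℕ in atTop, c ≤ Real.sqrt (Real.sqrt n) :=
  (Real.tendsto_sqrt_atTop.comp (Real.tendsto_sqrt_atTop.comp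
    tendsto_natCast_atTop_atTop)).eventually_ge_atTop c

/-- Both total rates are linear up to O(1), so the main terms A * d cancel. The factor 1 + 2βη
leaves O(η) because β * n is constant. -/
lemma rate_excess_le {A C₀ n d β η R Q K : ℝ} (hA : 0 ≤ A) (hC₀ : 0 ≤ C₀) (hn1 : 1 ≤ n)
    (hdn : d ≤ n) (hd0 : 0 ≤ d) (hη1 : 1 ≤ η) (hβ0 : 0 ≤ β) (hβn : β * n = K)
    (hR : |R - A * n| ≤ C₀) (hQ : |Q - A * d| ≤ C₀) :
    R * (1 + 2 * β * η) * (d / n) - Q ≤ (2 * C₀ + 2 * K * (A + C₀)) * η := by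
  have hn0 : 0 < n := by linarith
  have hη0 : 0 < η := by linarith
  have h1 := (abs_le.1 hR).2
  have h2 := (abs_le.1 hQ).1
  have hnd : n * (d / n) = d := mul_div_cancel₀ _ hn0.ne'
  have hdn1 : d / n ≤ 1 := (div_le_one hn0).2 hdn
  have hdn0 : 0 ≤ d / n := by positivity
  have h3 : R * (1 + 2 * β * η) * (d / n) ≤ (A * n + C₀) * (1 + 2 * β * η) * (d / n) := by
    have : R ≤ A * n + C₀ := by linarith
    have hβη0 : 0 ≤ 1 + 2 * β * η := by positivity
    gcongr
  have h4 : (A * n + C₀) * (1 + 2 * β * η) * (d / n) =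
      A * d + C₀ * (d / n) + (A * n + C₀) * (2 * β * η) * (d / n) := by
    linear_combination A * hnd
  have h5 : C₀ * (d / n) ≤ C₀ := mul_le_of_le_one_right hC₀ hdn1
  have h6 : (A * n + C₀) * (2 * β * η) * (d / n) ≤ ((A + C₀) * n) * (2 * β * η) * 1 := by
    have : A * n + C₀ ≤ (A + C₀) * n := by nlinarith
    gcongr
  have h7 : ((A + C₀) * n) * (2 * β * η) * 1 = 2 * K * (A + C₀) * η := by
    linear_combination 2 * (A + C₀) * η * hβn
  have h8 : 2 * C₀ ≤ 2 * C₀ * η := le_mul_of_one_le_right (by positivity) hη1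
  rw [add_mul]
  linarith

set_option maxHeartbeats 1000000 in
/-- Near superadditivity of the expected log-count on balanced splittings. -/
lemma exists_meanLogSols_add_le {α : ℝ} (hk1 : 1 ≤ k) (hα : 0 < α)
    (h : 2 ≤ k ∨ (k = 1 ∧ α < 2)) :
    ∃ (n₀ : ℕ) (C : ℝ), 0 ≤ C ∧ ∀ a b, n₀ ≤ a → n₀ ≤ b → a + b ≤ 4 * a → a + b ≤ 4 * b →
      meanLogSols k α a + meanLogSols k α b ≤ meanLogSols k α (a + b) + 2 +
        ((a + b : ℕ) + 2) * (P k a α 0 + P k b α 0) +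
        ((a + b : ℕ) + 1) * (C / Real.sqrt (Real.sqrt (a + b : ℕ))) := by
  obtain ⟨N₀, A, C₀, hA, hC₀, hrate⟩ := exists_rate_estimate hα h
  -- 1/w bounds from below the ratio of the `k`-sets of a block to all `k`-sets: the power is at
  -- least (1/4)^k = 4/w, and the surplus absorbs the factor 2 and the additive error. The threshold
  -- `N₁` makes that error at most 1/w.
  set w : ℝ := 4 * 4 ^ k with hw
  have hw0 : 0 < w := by positivity
  obtain ⟨N₁, hN₁⟩ := eventually_atTop.1 (eventually_le_sqrt_sqrt (8 * (k : ℝ) ^ 2 * w + 1))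
  set C₁ : ℝ := 2 * C₀ + 8 * (k : ℝ) ^ 2 * (A + C₀) with hC₁
  have hC₁0 : 0 ≤ C₁ := by positivity
  set c₂ : ℝ := 2 ^ k * (2 ^ k * w) / α with hc₂
  refine ⟨max N₀ N₁, 2 * C₁ * Real.sqrt c₂ + (A + C₀) * (8 * (k : ℝ) ^ 2), by positivity,
    fun a b ha hb hab1 hab2 => ?_⟩
  obtain ⟨n, hn⟩ : ∃ n, n = a + b := ⟨_, rfl⟩
  have haN : N₀ ≤ a := (le_max_left _ _).trans ha
  have hbN : N₀ ≤ b := (le_max_left _ _).trans hb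
  have hnN₁ : N₁ ≤ n := ((le_max_right _ _).trans ha).trans (by omega)
  obtain ⟨hak, pa0, pa1, pae, par⟩ := hrate a haN
  obtain ⟨hbk, pb0, pb1, pbe, pbr⟩ := hrate b hbN
  obtain ⟨hnk, pn0, pn1, pne, pnr⟩ := hrate n (by omega)
  -- The choice n^(1/4) balances the multiplicative error, of order η / sqrt n per variable, with
  -- the additive one, of order 1/η.
  set η : ℝ := Real.sqrt (Real.sqrt n) with hη
  have hηbig : 8 * (k : ℝ) ^ 2 * w + 1 ≤ η := hN₁ n hnN₁
  have hη1 : 1 ≤ η := by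
    have : 0 ≤ 8 * (k : ℝ) ^ 2 * w := by positivity
    linarith
  have hη0 : 0 < η := by linarith
  have hη2 : η ^ 2 = Real.sqrt n := Real.sq_sqrt (Real.sqrt_nonneg _)
  have hη4 : η ^ 4 = n := by
    have : η ^ 4 = (η ^ 2) ^ 2 := by ring
    rw [this, hη2, Real.sq_sqrt (by positivity)]
  have hn1 : (1 : ℝ) ≤ n := by exact_mod_cast (by omega : 1 ≤ n)
  have hn0 : (0 : ℝ) < n := by linarith
  have ha0 : (0 : ℝ) < a := by exact_mod_cast (by omega : 0 < a)
  have hb0 : (0 : ℝ) < b := by exact_mod_cast (by omega : 0 < b)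
  have hnab : (n : ℝ) = a + b := by rw [hn]; push_cast; ring
  have ha4 : (n : ℝ) ≤ 4 * a := by rw [hn]; exact_mod_cast hab1
  have hb4 : (n : ℝ) ≤ 4 * b := by rw [hn]; exact_mod_cast hab2
  -- The 4 allows for blocks as small as n/4.
  set β : ℝ := 4 * (k : ℝ) ^ 2 / n with hβ
  have hβ0 : 0 ≤ β := by positivity
  have hβn : β * n = 4 * (k : ℝ) ^ 2 := div_mul_cancel₀ _ hn0.ne'
  have hβle : ∀ d : ℝ, 0 < d → (n : ℝ) ≤ 4 * d → (k : ℝ) ^ 2 / d ≤ β := by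
    intro d hd hd4
    rw [hβ, div_le_div_iff₀ hd hn0]
    linarith [mul_le_mul_of_nonneg_left hd4 (sq_nonneg (k : ℝ))]
  have hηn : η ≤ n := by
    rw [← hη4]
    calc η = η ^ 1 := (pow_one η).symm
      _ ≤ η ^ 4 := pow_le_pow_right₀ hη1 (by norm_num)
  have hw4 : 4 ≤ w := by
    have : (1 : ℝ) ≤ 4 ^ k := one_le_pow₀ (by norm_num)
    rw [hw]; linarith
  have hβη : β * η ≤ 1 / 2 := by
    have e : β * η = 4 * (k : ℝ) ^ 2 / η ^ 3 := by
      rw [hβ, ← hη4]; field_simp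
    rw [e, div_le_div_iff₀ (by positivity) (by norm_num)]
    have : η ≤ η ^ 3 := by
      calc η = η ^ 1 := (pow_one η).symm
        _ ≤ η ^ 3 := pow_le_pow_right₀ hη1 (by norm_num)
    linarith [mul_le_mul_of_nonneg_left hw4 (sq_nonneg (k : ℝ)), sq_nonneg (k : ℝ)]
  have hβη2 : 2 * β / η = 8 * (k : ℝ) ^ 2 / (n * η) := by
    rw [hβ]; field_simp; ring
  have hratio : ∀ d : ℕ, d ≤ n → (n : ℝ) ≤ 4 * d → 1 / w ≤ (d.choose k : ℝ) / n.choose k := by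
    intro d hdn hd4
    have h1 := pow_le_one_add_mul_choose_div_choose hdn hk1 hnk
      (hβle n hn0 (by linarith)) hη1 hβη
    have h2 : ((1 : ℝ) / 4) ^ k ≤ ((d : ℝ) / n) ^ k := by
      refine pow_le_pow_left₀ (by norm_num) ?_ k
      rw [div_le_div_iff₀ (by norm_num) hn0]
      linarith
    have h3 : ((1 : ℝ) / 4) ^ k = 4 * (1 / w) := by
      rw [hw, div_pow, one_pow]; field_simp
    have h4 : 2 * β / η ≤ 1 / w := by
      rw [hβη2, div_le_div_iff₀ (by positivity) hw0]
      have : 1 * η ≤ n * η := mul_le_mul_of_nonneg_right hn1 hη0.le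
      linarith
    have h5 : 0 ≤ (d.choose k : ℝ) / n.choose k := by positivity
    have h6 : (1 + 2 * β * η) * ((d.choose k : ℝ) / n.choose k) ≤
        2 * ((d.choose k : ℝ) / n.choose k) := by
      refine mul_le_mul_of_nonneg_right ?_ h5
      linarith
    have h7 : 0 < 1 / w := by positivity
    linarith
  -- A common lower bound for p times the number of `k`-sets of a block, valid at both ends of the
  -- path.
  set v : ℝ := α * n / (2 ^ k * w) with hv
  have hv0 : 0 < v := by positivity
  have hvn : ∀ d : ℕ, d ≤ n → (n : ℝ) ≤ 4 * d →
      v ≤ d.choose k * (1 - Real.exp (-rate (clauseProb k n α))) := by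
    intro d hdn hd4
    rw [exp_neg_rate pn1]
    have hM : (0 : ℝ) < n.choose k := by exact_mod_cast Nat.choose_pos (by omega)
    have h1 := hratio d hdn hd4
    rw [le_div_iff₀ hM] at h1
    have h2 : v = 1 / w * n.choose k * clauseProb k n α := by
      rw [mul_assoc, pne, hv]; field_simp
    rw [h2]
    have := mul_le_mul_of_nonneg_right h1 pn0.le
    linarith
  have hvd : ∀ d : ℕ, (n : ℝ) ≤ 4 * d → (clauseProb k d α : ℝ) < 1 →
      d.choose k * (clauseProb k d α : ℝ) = α * d / 2 ^ k →
      v ≤ d.choose k * (1 - Real.exp (-rate (clauseProb k d α))) := by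
    intro d hd4 hp1 he
    rw [exp_neg_rate hp1, sub_sub_cancel, he, hv, div_le_div_iff₀ (by positivity) (by positivity)]
    have h2k : (0 : ℝ) < 2 ^ k := by positivity
    have : α * n * 2 ^ k ≤ α * (w * d) * 2 ^ k := by
      have : (n : ℝ) ≤ w * d := hd4.trans (by gcongr)
      gcongr
    linarith
  have hκ : ∀ d : ℕ, (d : ℝ) ≤ n →
      |rate (clauseProb k d α) * d.choose k - A * d| ≤ C₀ →
      rate (clauseProb k n α) * n.choose k * (1 + 2 * β * η) * ((d : ℝ) / n) -
        rate (clauseProb k d α) * d.choose k ≤ C₁ * η :=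
    fun d hdn hd => (rate_excess_le hA hC₀ hn1 hdn (Nat.cast_nonneg d) hη1 hβ0 hβn pnr hd).trans
      (le_of_eq (by rw [hC₁]; ring))
  subst hn
  have hra := lt_of_lt_of_le pa0 (le_rate pa1)
  have hrb := lt_of_lt_of_le pb0 (le_rate pb1)
  have hrn := lt_of_lt_of_le pn0 (le_rate pn1)
  have hmain := clockExp_splitRate_le hk1 hak hbk (hβle a ha0 ha4) (hβle b hb0 hb4) hη1 hβη
    hrn hra hrb (κ := C₁ * η) (v := v) (by positivity) hv0
    (by rw [← hnab]; exact hκ a (by linarith) par) (by rw [← hnab]; exact hκ b (by linarith) pbr)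
    (hvn a (by omega) ha4) (hvd a ha4 pa1 pae) (hvn b (by omega) hb4) (hvd b hb4 pb1 pbe)
  have hsplit := clockExp_add_clockExp_le_splitRate (a := a) (b := b) hk1 hra.le hrb.le
  rw [← formulaLaw_real_Z_eq_zero pa1, ← formulaLaw_real_Z_eq_zero pb1, ← P_zero_eq,
    ← P_zero_eq] at hsplit
  have hfin : 2 * (C₁ * η) * Real.sqrt (2 ^ k / v) +
      rate (clauseProb k (a + b) α) * (a + b).choose k * (2 * β / η) ≤
      (2 * C₁ * Real.sqrt c₂ + (A + C₀) * (8 * (k : ℝ) ^ 2)) / η := by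
    have e1 : (2 : ℝ) ^ k / v = c₂ / (a + b : ℕ) := by
      rw [hv, hc₂]; field_simp
    rw [e1, Real.sqrt_div' _ hn0.le, ← hη2, hβη2]
    have e2 : rate (clauseProb k (a + b) α) * (a + b).choose k ≤ (A + C₀) * (a + b : ℕ) := by
      have := (abs_le.1 pnr).2
      nlinarith
    have e3 : rate (clauseProb k (a + b) α) * (a + b).choose k *
        (8 * (k : ℝ) ^ 2 / ((a + b : ℕ) * η)) ≤
        ((A + C₀) * (a + b : ℕ)) * (8 * (k : ℝ) ^ 2 / ((a + b : ℕ) * η)) := by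
      gcongr
    refine (add_le_add_right e3 _).trans (le_of_eq ?_)
    field_simp
  have hfin' := mul_le_mul_of_nonneg_left hfin (by positivity : (0 : ℝ) ≤ (a + b : ℕ) + 1)
  unfold meanLogSols
  linarith

end asymptotics

/-! ### Convergence of the mean log-count and passage to the conditional expectation -/

section limit

variable {k : ℕ}

lemma eventually_log_rpow_le_sqrt_sqrt (s : ℝ) :
    ∀ᶠ n : ℕ in atTop, Real.log n ^ s ≤ Real.sqrt (Real.sqrt n) := by
  have h := (isLittleO_log_rpow_rpow_atTop s (show (0 : ℝ) < 1 / 4 by norm_num)).bound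
    (show (0 : ℝ) < 1 by norm_num)
  filter_upwards [tendsto_natCast_atTop_atTop.eventually h, eventually_ge_atTop 1] with n hn hn1
  have hn1' : (1 : ℝ) ≤ n := by exact_mod_cast hn1
  have h0 : 0 ≤ Real.log n := Real.log_nonneg hn1'
  rw [Real.norm_of_nonneg (by positivity), Real.norm_of_nonneg (by positivity), one_mul] at hn
  refine hn.trans (le_of_eq ?_)
  rw [Real.sqrt_eq_rpow, Real.sqrt_eq_rpow, ← Real.rpow_mul (by positivity)]
  norm_num

lemma exists_tendsto_meanLogSols {α : ℝ} (hk1 : 1 ≤ k) (hα : 0 < α)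
    (h : 2 ≤ k ∨ (k = 1 ∧ α < 2)) {ε : ℝ} (hε : 0 < ε)
    (hP : (fun n : ℕ => P k n α 0) =O[atTop] (fun n : ℕ => 1 / (Real.log n) ^ (1 + ε))) :
    ∃ L, Tendsto (fun n : ℕ => meanLogSols k α n / n) atTop (𝓝 L) := by
  obtain ⟨N₀, C, hC, hsup⟩ := exists_meanLogSols_add_le hk1 hα h
  obtain ⟨N₁, _, _, _, _, hrate⟩ := exists_rate_estimate hα h
  obtain ⟨C₃, hC₃, hbound⟩ := hP.exists_pos
  obtain ⟨N₂, hN₂⟩ := eventually_atTop.1 hbound.bound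
  obtain ⟨N₃, hN₃⟩ := eventually_atTop.1 (eventually_log_rpow_le_sqrt_sqrt (1 + ε))
  set m₀ := max (max N₀ N₁) (max (max N₂ N₃) 16) with hm₀
  have hPle : ∀ d n : ℕ, m₀ ≤ d → m₀ ≤ n → n ≤ 4 * d →
      P k d α 0 ≤ C₃ * 2 ^ (1 + ε) * (1 / Real.log n ^ (1 + ε)) := by
    intro d n hd hn hdn
    have hd16 : 16 ≤ d := by omega
    have hn16 : (16 : ℝ) ≤ n := by exact_mod_cast (by omega : 16 ≤ n)
    have hlogn : 0 < Real.log n := Real.log_pos (by linarith)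
    -- Since d ≥ 16, n ≤ 4d ≤ d². Passing from log d to log n therefore costs only the constant
    -- 2^(1+ε).
    have hlogd : Real.log n / 2 ≤ Real.log d := by
      rw [div_le_iff₀ (by norm_num), mul_comm]
      have hd0 : (0 : ℝ) < d := by exact_mod_cast (by omega : 0 < d)
      have : (2 : ℝ) * Real.log d = Real.log ((d : ℝ) ^ 2) := by
        rw [Real.log_pow]; push_cast; ring
      rw [this]
      refine Real.log_le_log (by linarith) ?_
      exact_mod_cast (by nlinarith : n ≤ d ^ 2)
    have h1 := hN₂ d (by omega)
    have h2 : 0 < Real.log d := lt_of_lt_of_le (by linarith) hlogd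
    rw [Real.norm_of_nonneg (show 0 ≤ 1 / Real.log d ^ (1 + ε) by positivity)] at h1
    refine (le_abs_self _).trans (h1.trans ?_)
    rw [mul_assoc]
    refine mul_le_mul_of_nonneg_left ?_ hC₃.le
    have h3 : (Real.log n / 2) ^ (1 + ε) ≤ Real.log d ^ (1 + ε) :=
      Real.rpow_le_rpow (by positivity) hlogd (by linarith)
    rw [Real.div_rpow hlogn.le (by norm_num)] at h3
    calc 1 / Real.log d ^ (1 + ε) ≤ 1 / (Real.log n ^ (1 + ε) / 2 ^ (1 + ε)) :=
          one_div_le_one_div_of_le (by positivity) h3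
      _ = _ := by rw [one_div_div, mul_one_div]
  refine exists_tendsto_of_superadditive_log_error (n₀ := m₀) (B := 2)
    (C := 2 + 3 * (2 * (C₃ * 2 ^ (1 + ε))) + 2 * C) hε (by positivity) ?_ ?_
  · intro n hn
    exact abs_meanLogSols_le (hrate n (by omega)).2.2.1 (by omega)
  · intro a b ha hb hab1 hab2
    have hmain := hsup a b (by omega) (by omega) hab1 hab2
    have hPa := hPle a (a + b) ha (by omega) hab1
    have hPb := hPle b (a + b) hb (by omega) hab2
    have hn := hN₃ (a + b) (by omega)
    have hn16 : (16 : ℝ) ≤ (a + b : ℕ) := by exact_mod_cast (by omega : 16 ≤ a + b)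
    refine hmain.trans ?_
    generalize ((a + b : ℕ) : ℝ) = n at *
    have hlogn : 0 < Real.log n := Real.log_pos (by linarith)
    set y := Real.log n ^ (1 + ε) with hy
    have hy0 : 0 < y := Real.rpow_pos_of_pos hlogn _
    have hsn : Real.sqrt (Real.sqrt n) ≤ n := by
      have h1 : Real.sqrt n ≤ n := by
        rw [Real.sqrt_le_left (by linarith)]; nlinarith
      have h2 : 1 ≤ Real.sqrt n := by
        rw [Real.one_le_sqrt]; linarith
      refine le_trans ?_ h1
      rw [Real.sqrt_le_left (by linarith)]; nlinarith
    have e1 : 2 ≤ n * (2 / y) := by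
      rw [mul_div_assoc', le_div_iff₀ hy0]
      linarith
    have e2 : (n + 1) * (C / Real.sqrt (Real.sqrt n)) ≤ n * (2 * C / y) := by
      have : C / Real.sqrt (Real.sqrt n) ≤ C / y := by gcongr
      have h3 : 0 ≤ C / y := by positivity
      calc (n + 1) * (C / Real.sqrt (Real.sqrt n)) ≤ (n + 1) * (C / y) := by
            apply mul_le_mul_of_nonneg_left this; linarith
        _ ≤ (2 * n) * (C / y) := by
            apply mul_le_mul_of_nonneg_right _ h3; linarith
        _ = _ := by ring
    have e3 : (n + 2) * (P k a α 0 + P k b α 0) ≤ n * (3 * (2 * (C₃ * 2 ^ (1 + ε))) / y) := by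
      have h4 : 0 ≤ C₃ * 2 ^ (1 + ε) * (1 / y) := by positivity
      calc (n + 2) * (P k a α 0 + P k b α 0)
          ≤ (n + 2) * (2 * (C₃ * 2 ^ (1 + ε) * (1 / y))) := by
            apply mul_le_mul_of_nonneg_left; linarith; linarith
        _ ≤ (3 * n) * (2 * (C₃ * 2 ^ (1 + ε) * (1 / y))) := by
            apply mul_le_mul_of_nonneg_right; linarith; linarith
        _ = _ := by ring
    have e4 : n * ((2 + 3 * (2 * (C₃ * 2 ^ (1 + ε))) + 2 * C) / y) =
        n * (2 / y) + n * (3 * (2 * (C₃ * 2 ^ (1 + ε))) / y) + n * (2 * C / y) := by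
      rw [add_div, add_div]; ring
    rw [e4]
    linarith

/-- The expectation of the logarithm of the number of solutions on the event of satisfiability. -/
noncomputable def meanLogSat (k : ℕ) (α : ℝ) (n : ℕ) : ℝ :=
  ∫ F, Set.indicator {F : Formula k n | 1 ≤ Z F} (fun F => Real.log (Z F)) F ∂(formulaLaw k n α)

instance isProbabilityMeasure_formulaLaw (k n : ℕ) (α : ℝ) :
    IsProbabilityMeasure (formulaLaw k n α) := by
  unfold formulaLaw; infer_instance

lemma formulaLaw_real_one_le_Z (k n : ℕ) (α : ℝ) :
    (formulaLaw k n α).real {F | 1 ≤ Z F} = 1 - P k n α 0 := by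
  rw [P_zero_eq, ← probReal_compl_eq_one_sub (Set.toFinite _).measurableSet]
  congr 1
  ext F
  simp [Nat.one_le_iff_ne_zero]

lemma psi_eq (k n : ℕ) (α : ℝ) :
    psi k n α = (1 - P k n α 0)⁻¹ * (meanLogSat k α n / n) / Real.log 2 := by
  unfold psi ProbabilityTheory.cond meanLogSat
  rw [integral_smul_measure, integral_indicator (Set.toFinite _).measurableSet,
    ENNReal.toReal_inv, ← measureReal_def, formulaLaw_real_one_le_Z]
  simp only [Real.logb]
  rw [integral_div, smul_eq_mul]
  ring

/-- Pointwise, log(1+z) - log z ≤ log 2 for z ≥ 1, and both terms vanish at z = 0. -/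
lemma abs_meanLogSols_sub_meanLogSat_le {n : ℕ} {α : ℝ} (hp : (clauseProb k n α : ℝ) < 1) :
    |meanLogSols k α n - meanLogSat k α n| ≤ 1 := by
  have hr : ∀ _ : Clause k n, 0 ≤ rate (clauseProb k n α) :=
    fun _ => rate_nonneg (clauseProb k n α).2.1 hp
  rw [meanLogSat, integral_formulaLaw hp, meanLogSols, ← clockExp_sub]
  have hpt : ∀ ω : Clause k n → Bool, 0 ≤ logSols ω -
      Set.indicator {F : Formula k n | 1 ≤ Z F} (fun F => Real.log (Z F)) (toFormula ω) ∧
      logSols ω - Set.indicator {F : Formula k n | 1 ≤ Z F} (fun F => Real.log (Z F))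
        (toFormula ω) ≤ 1 := by
    intro ω
    by_cases h : 1 ≤ Z (toFormula ω)
    · rw [Set.indicator_of_mem (by exact h), Z_toFormula]
      rw [Z_toFormula] at h
      have h1 : (1 : ℝ) ≤ (sols ω).card := by exact_mod_cast h
      have h0 : (0 : ℝ) < (sols ω).card := by linarith
      unfold logSols
      constructor
      · rw [sub_nonneg]
        exact Real.log_le_log h0 (by linarith)
      · rw [← Real.log_div (by positivity) h0.ne']
        have h2 : (1 + ((sols ω).card : ℝ)) / (sols ω).card ≤ 2 := by
          rw [div_le_iff₀ h0]; linarith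
        have h3 := Real.log_le_log (by positivity) h2
        linarith [Real.log_two_lt_d9]
    · rw [Set.indicator_of_notMem (by exact h)]
      rw [Z_toFormula] at h
      have : (sols ω).card = 0 := by omega
      simp [logSols, this]
  have h1 := clockExp_nonneg hr fun ω => (hpt ω).1
  have h2 := clockExp_mono hr fun ω => (hpt ω).2
  rw [clockExp_const] at h2
  rw [abs_of_nonneg h1]
  exact h2

lemma tendsto_P_zero {α ε : ℝ} (hε : 0 < ε)
    (hP : (fun n : ℕ => P k n α 0) =O[atTop] (fun n : ℕ => 1 / (Real.log n) ^ (1 + ε))) :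
    Tendsto (fun n : ℕ => P k n α 0) atTop (𝓝 0) := by
  refine hP.trans_tendsto ?_
  have h := (tendsto_rpow_neg_atTop (show 0 < 1 + ε by linarith)).comp
    (Real.tendsto_log_atTop.comp tendsto_natCast_atTop_atTop)
  refine h.congr' ?_
  filter_upwards [eventually_ge_atTop 1] with n hn
  have hn1 : (1 : ℝ) ≤ n := by exact_mod_cast hn
  simp only [Function.comp_apply]
  rw [Real.rpow_neg (Real.log_nonneg hn1), one_div]

lemma exists_tendsto_psi {α : ℝ} (hk1 : 1 ≤ k) (hα : 0 < α)
    (h : 2 ≤ k ∨ (k = 1 ∧ α < 2)) {ε : ℝ} (hε : 0 < ε)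
    (hP : (fun n : ℕ => P k n α 0) =O[atTop] (fun n : ℕ => 1 / (Real.log n) ^ (1 + ε))) :
    ∃ L, Tendsto (fun n : ℕ => psi k n α) atTop (𝓝 L) := by
  obtain ⟨L, hL⟩ := exists_tendsto_meanLogSols hk1 hα h hε hP
  obtain ⟨N₁, _, _, _, _, hrate⟩ := exists_rate_estimate hα h
  have hdiff : Tendsto (fun n : ℕ => (meanLogSols k α n - meanLogSat k α n) / n) atTop (𝓝 0) := by
    refine squeeze_zero_norm' ?_ tendsto_one_div_atTop_nhds_zero_nat
    filter_upwards [eventually_ge_atTop N₁] with n hn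
    rw [norm_div, Real.norm_eq_abs, Real.norm_natCast]
    exact div_le_div_of_nonneg_right (abs_meanLogSols_sub_meanLogSat_le (hrate n hn).2.2.1)
      (by positivity)
  have hsat : Tendsto (fun n : ℕ => meanLogSat k α n / n) atTop (𝓝 L) := by
    have := hL.sub hdiff
    rw [sub_zero] at this
    refine this.congr fun n => ?_
    ring
  have hinv : Tendsto (fun n : ℕ => (1 - P k n α 0)⁻¹) atTop (𝓝 1) := by
    have h1 := (tendsto_P_zero hε hP).const_sub 1
    rw [sub_zero] at h1
    have := h1.inv₀ one_ne_zero
    rwa [inv_one] at this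
  have := (hinv.mul hsat).div_const (Real.log 2)
  exact ⟨_, this.congr fun n => (psi_eq k n α).symm⟩

lemma Z_empty (k n : ℕ) : Z (∅ : Formula k n) = 2 ^ n := by
  have : {x : Fin n → Bool | Satisfies x (∅ : Formula k n)} = Set.univ := by
    ext x; simp [Satisfies]
  rw [Z, this, Set.ncard_univ]
  simp

lemma psi_zero {n : ℕ} (hn : 1 ≤ n) : psi k n 0 = 1 := by
  have hlaw : formulaLaw k n 0 = Measure.dirac ∅ := by
    have : clauseProb k n 0 = 0 := by
      unfold clauseProb
      rw [zero_mul, zero_div]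
      exact Set.projIcc_left (zero_le_one (α := ℝ))
    rw [formulaLaw, this, setBernoulli_zero]
  have hP : P k n 0 0 = 0 := by
    rw [P_zero_eq, hlaw, measureReal_def, Measure.dirac_apply' _ (Set.toFinite _).measurableSet]
    simp [Z_empty]
  have hn0 : (n : ℝ) ≠ 0 := by positivity
  have hlog : Real.log 2 ≠ 0 := (Real.log_pos (by norm_num)).ne'
  have hmean : meanLogSat k 0 n = n * Real.log 2 := by
    rw [meanLogSat, hlaw, integral_dirac, Set.indicator_of_mem, Z_empty]
    · push_cast
      rw [Real.log_pow]
    · simp [Z_empty, Nat.one_le_two_pow]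
  rw [psi_eq, hP, hmean]
  field_simp
  simp

/-- Adding a clause cannot restore satisfiability, so raising all the rates can only increase the
probability of unsatisfiability. -/
lemma P_mono {n : ℕ} {α α' : ℝ} (h : α ≤ α') (hp : (clauseProb k n α' : ℝ) < 1) :
    P k n α 0 ≤ P k n α' 0 := by
  have hle : (clauseProb k n α : ℝ) ≤ clauseProb k n α' := clauseProb_mono n h
  have hp' : (clauseProb k n α : ℝ) < 1 := lt_of_le_of_lt hle hp
  rw [P_zero_eq, P_zero_eq, formulaLaw_real_Z_eq_zero hp, formulaLaw_real_Z_eq_zero hp']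
  exact clockExp_le_clockExp (fun _ => rate_nonneg (clauseProb k n α).2.1 hp')
    (fun _ => rate_mono hle hp) unsatInd_le_update

/-- The clause probability is then 1, so a variable and its negation both occur as clauses. This
excludes densities at least 2 when k = 1. -/
lemma P_one_eq_one {n : ℕ} (hn : 1 ≤ n) {α : ℝ} (hα : 2 ≤ α) : P 1 n α 0 = 1 := by
  have hn0 : (0 : ℝ) < n := by exact_mod_cast hn
  have hlaw : formulaLaw 1 n α = Measure.dirac Set.univ := by
    have : clauseProb 1 n α = 1 := by
      unfold clauseProb
      refine Set.projIcc_of_right_le _ ?_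
      rw [Nat.choose_one_right, le_div_iff₀ (by positivity)]
      nlinarith
    rw [formulaLaw, this, setBernoulli_one]
  have hZ : Z (Set.univ : Formula 1 n) = 0 := by
    have : {x : Fin n → Bool | Satisfies x (Set.univ : Formula 1 n)} = ∅ := by
      ext x
      simp only [Set.mem_ofPred_eq, Set.mem_empty_iff_false, iff_false]
      intro hx
      obtain ⟨l, hl, hxl⟩ := hx ⟨{(⟨0, hn⟩, !x ⟨0, hn⟩)}, by simp⟩ (Set.mem_univ _)
      rw [Finset.mem_singleton] at hl
      subst hl
      simp at hxl
    rw [Z, this, Set.ncard_empty]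
  rw [P_zero_eq, hlaw, measureReal_def, Measure.dirac_apply' _ (Set.toFinite _).measurableSet]
  simp [hZ]

lemma exists_tendsto_psi_of_lt_alphaStar (hk : 1 ≤ k) {α : ℝ} (hα : 0 ≤ α)
    (hlt : (α : EReal) < alphaStar k) : ∃ L, Tendsto (fun n : ℕ => psi k n α) atTop (𝓝 L) := by
  -- The interpolation needs positive rates, so α = 0, where the formula is almost surely empty, is
  -- treated apart.
  rcases hα.eq_or_lt with rfl | hα0
  · refine ⟨1, tendsto_const_nhds.congr' ?_⟩
    filter_upwards [eventually_ge_atTop 1] with n hn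
    exact (psi_zero hn).symm
  -- The decay bound is known only at some larger density `α'` in the defining set; `P_mono` carries
  -- it down to `α`.
  obtain ⟨_, ⟨α', ⟨-, ε, hε, hP'⟩, rfl⟩, hαα'⟩ := lt_sSup_iff.1 hlt
  have hle : α ≤ α' := (EReal.coe_lt_coe_iff.1 hαα').le
  have h' : 2 ≤ k ∨ (k = 1 ∧ α' < 2) := by
    rcases Nat.lt_or_ge 1 k with h | h
    · exact Or.inl h
    · have hk1 : k = 1 := le_antisymm h hk
      subst hk1
      refine Or.inr ⟨rfl, ?_⟩
      by_contra hcon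
      have h0 := tendsto_P_zero hε hP'
      have h1 : Tendsto (fun n : ℕ => P 1 n α' 0) atTop (𝓝 1) := by
        refine tendsto_const_nhds.congr' ?_
        filter_upwards [eventually_ge_atTop 1] with n hn
        exact (P_one_eq_one hn (not_lt.1 hcon)).symm
      exact zero_ne_one (tendsto_nhds_unique h0 h1)
  have h : 2 ≤ k ∨ (k = 1 ∧ α < 2) := h'.imp_right fun ⟨h1, h2⟩ => ⟨h1, hle.trans_lt h2⟩
  refine exists_tendsto_psi hk hα0 h hε (IsBigO.trans ?_ hP')
  obtain ⟨N₁, _, _, _, _, hrate⟩ := exists_rate_estimate (hα0.trans_le hle) h'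
  refine IsBigO.of_bound 1 ?_
  filter_upwards [eventually_ge_atTop N₁] with n hn
  rw [one_mul, Real.norm_of_nonneg (by exact measureReal_nonneg),
    Real.norm_of_nonneg (by exact measureReal_nonneg)]
  exact P_mono hle (hrate n hn).2.2.1

end limit

end RandomKSat

theorem theorem3 (k : ℕ) (hk : 1 ≤ k) :
    ∃ φ_s : ℝ → ℝ, ∀ α : ℝ, 0 ≤ α → (α : EReal) < RandomKSat.alphaStar k →
      Tendsto (fun n : ℕ => RandomKSat.psi k n α) atTop (𝓝 (φ_s α)) := by
  have h : ∀ α : ℝ, ∃ L, 0 ≤ α → (α : EReal) < RandomKSat.alphaStar k →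
      Tendsto (fun n : ℕ => RandomKSat.psi k n α) atTop (𝓝 L) := by
    intro α
    by_cases hα : 0 ≤ α ∧ (α : EReal) < RandomKSat.alphaStar k
    · obtain ⟨L, hL⟩ := RandomKSat.exists_tendsto_psi_of_lt_alphaStar hk hα.1 hα.2
      exact ⟨L, fun _ _ => hL⟩
    · exact ⟨0, fun h0 h1 => absurd ⟨h0, h1⟩ hα⟩
  choose φ_s hφ using h
  exact ⟨φ_s, hφ⟩
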